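/- Let $n\ge 1$ be an integer (the blocklength), $\lambda>0$ and $\epsilon>0$ with $\lambda n<1-\epsilon$. Packets arrive in the channel uses (CUs) according to an i.i.d. Bernoulli($\lambda$) process and are served by a single-server first-come first-served queue that is initially empty. The numbers of codeword transmissions needed to deliver the packets are i.i.d. geometric, $\mathbb P\{X=k\}=(1-\epsilon)\epsilon^{k-1}$ for $k\ge1$, and independent of the arrivals; each transmission takes $n$ CUs. Two models are considered. *Frame-synchronous model.* Time is measured in frames of $n$ CUs. All packets arriving within the same frame form a bulk (if there is at least one); $\alpha_m$ is the index of the frame in which the $m$th bulk arrives, and its service time $S_m$ is the sum of the numbers of transmissions needed by its packets. *Frame-asynchronous model.* Time is measured in CUs; $\alpha_m$ is the CU in which the $m$th packet arrives and its service time $S_m$ is $n$ times the number of its transmissions. In both models service can start no earlier than in the slot (frame or CU, respectively) following $\alpha_m$, so the $m$th customer (bulk or packet) departs at the end of slot $\tau_1=\alpha_1+S_1$, $\tau_m=\max\{\tau_{m-1},\alpha_m\}+S_m$ for $m\ge2$. Its delay is $D_m=\tau_m-\alpha_m$, and the $m$th peak age of information is $A_m=\max\{D_{m-1},\alpha_m-\alpha_{m-1}\}+S_m$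 for $m\ge2$. Then, in both models, $D_m$ and $A_m$ converge in distribution to a steady-state delay $D$ and a steady-state peak age $A$, where $A$ is distributed as $\max\{D,\alpha_2-\alpha_1\}+S_1$ with $D$ independent of $(\alpha_2-\alpha_1,S_1)$. For $s\in\mathbb C$, $s\neq1$, the probability-generating functions $G_D(s)=\mathbb E[s^D]$ and $G_A(s)=\mathbb E[s^A]$ are as follows, whenever $\mathbb E[|s|^D]<\infty$ and $\mathbb E[|s|^A]<\infty$, respectively (in particular for $|s|\le1$, $s\ne 1$). For the frame-synchronous model, $$G_A(s)=\frac{(1-\lambda+(\lambda-\epsilon)s)^n-(1-\epsilon s)^n(1-\lambda)^n}{(1-\epsilon s)^n\,(1-(1-\lambda)^n)}\left(G_D(s)-\frac{(1-s)\,G_D((1-\lambda)^n s)}{1-(1-\lambda)^n s}\right),$$ where $$G_D(s)=\left(1-\frac{\lambda n}{1-\epsilon}\right)\frac{(1-s)\left((1-\lambda)^n(1-\epsilon s)^n-(1-\lambda+(\lambda-\epsilon)s)^n\right)}{(1-(1-\lambda)^n)\left(s(1-\epsilon s)^n-(1-\lambda+(\lambda-\epsilon)s)^n\right)}.$$ For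 the frame-asynchronous model, $$G_A(s)=\frac{(1-\epsilon)s^n}{1-\epsilon s^n}\left(G_D(s)-\frac{(1-s)\,G_D((1-\lambda)s)}{1-(1-\lambda)s}\right),$$ where $$G_D(s)=\frac{(s-1)(1-\epsilon-\lambda n)s^n}{s-(1-\lambda)-(\lambda+\epsilon(s-1))s^n}.$$ -/

import Mathlib

open MeasureTheory ProbabilityTheory Filter Topology

noncomputable section

namespace PeakAge

/-- The random primitives of the two queueing models on a probability space `(Ω, P)`.
`arr c ω` says whether a packet arrives in channel use `c`; the arrivals are i.i.d. Bernoulli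
with parameter `lam`.  `X i ω` is the number of codeword transmissions (first transmission and
retransmissions) needed to deliver the packet with label `i`; these are i.i.d. geometric on
`{1, 2, …}` with success probability `1 - ε`, and independent of the arrivals. -/
structure IsTrafficModel {Ω ι : Type*} [MeasurableSpace Ω] (P : Measure Ω) (lam ε : ℝ)
    (arr : ℕ → Ω → Bool) (X : ι → Ω → ℕ) : Prop where
  measurable_arr : ∀ c, Measurable (arr c)
  measurable_X : ∀ i, Measurable (X i)
  bernoulli : ∀ c, P.real {ω | arr c ω = true} = lam
  geometric : ∀ i k, P.real {ω | X i ω = k + 1} = (1 - ε) * ε ^ k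
  indep_arr : iIndepFun arr P
  indep_X : iIndepFun X P
  indep : IndepFun (fun ω c => arr c ω) (fun ω i => X i ω) P

/-- Departure times of a single-server first-come first-served queue that is initially empty:
customer `m` arrives in slot `α m` and needs `S m` slots of service, which can start no earlier
than slot `α m + 1`; it leaves at the end of slot `departure α S m`. -/
def departure (α S : ℕ → ℕ) : ℕ → ℕ
  | 0 => α 0 + S 0
  | m + 1 => max (departure α S m) (α (m + 1)) + S (m + 1)

/-- The number of slots customer `m` waits before its service starts. -/
def waiting (α S : ℕ → ℕ) : ℕ → ℕ
  | 0 => 0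
  | m + 1 => max (departure α S m) (α (m + 1)) - α (m + 1)

/-- The delay of customer `m`: waiting time plus service time. -/
def delay (α S : ℕ → ℕ) (m : ℕ) : ℕ := waiting α S m + S m

/-- The peak age just before customer `m + 1` departs. -/
def peakAge (α S : ℕ → ℕ) (m : ℕ) : ℕ :=
  max (delay α S m) (α (m + 1) - α m) + S (m + 1)

theorem departure_eq (α S : ℕ → ℕ) (m : ℕ) : departure α S m = α m + delay α S m := by
  cases m with
  | zero => simp [departure, delay, waiting]
  | succ m => simp only [departure, delay, waiting]; omega

/-- Just before customer `m + 1` departs, the newest delivered update is the one of customer `m`,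
generated in slot `α m`; the age is the time elapsed since then. -/
theorem peakAge_eq (α S : ℕ → ℕ) (hα : Monotone α) (m : ℕ) :
    peakAge α S m = departure α S (m + 1) - α m := by
  have h := departure_eq α S m
  have h' := hα (Nat.le_succ m)
  simp only [Nat.succ_eq_add_one] at h'
  simp only [peakAge, departure]
  omega

/-! ### Frame-synchronous model -/

/-- The number of packets that arrive in frame `t`, which consists of the `n` channel uses
`t * n, …, t * n + n - 1`. -/
def frameCount (n : ℕ) (a : ℕ → Bool) (t : ℕ) : ℕ :=
  ∑ j ∈ Finset.range n, (a (t * n + j)).toNat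

/-- The index of the frame in which bulk `m` arrives (bulks are numbered from `0`). -/
def bulkArrival (n : ℕ) (a : ℕ → Bool) (m : ℕ) : ℕ :=
  Nat.nth (fun t => 0 < frameCount n a t) m

/-- The number of packets in bulk `m`. -/
def bulkSize (n : ℕ) (a : ℕ → Bool) (m : ℕ) : ℕ := frameCount n a (bulkArrival n a m)

/-- The service time of bulk `m` in frames, where `x (m, k)` is the number of frames needed to
deliver packet `k` of bulk `m`. -/
def bulkService (n : ℕ) (a : ℕ → Bool) (x : ℕ × ℕ → ℕ) (m : ℕ) : ℕ :=
  ∑ k ∈ Finset.range (bulkSize n a m), x (m, k)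

/-! ### Frame-asynchronous model -/

/-- The index of the channel use in which packet `m` arrives (packets are numbered from `0`). -/
def packetArrival (a : ℕ → Bool) (m : ℕ) : ℕ := Nat.nth (fun c => a c = true) m

/-- The service time of packet `m` in channel uses: `x m` transmissions of `n` channel uses. -/
def packetService (n : ℕ) (x : ℕ → ℕ) (m : ℕ) : ℕ := n * x m

/-! ### Steady state and generating functions -/

/-- `π` is the steady-state distribution of the process `Z`: it is a probability distribution on
`ℕ` and `Z m` converges to it in distribution as `m → ∞`. -/
structure IsSteadyState {Ω : Type*} [MeasurableSpace Ω] (P : Measure Ω) (Z : ℕ → Ω → ℕ)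
    (π : Measure ℕ) : Prop where
  isProbabilityMeasure : IsProbabilityMeasure π
  tendsto : ∀ k : ℕ, Tendsto (fun m => P {ω | k ≤ Z m ω}) atTop (𝓝 (π {j | k ≤ j}))

/-- The probability-generating function of a distribution on `ℕ`; it is defined at those `s` with
`Integrable (fun k : ℕ => s ^ k) π`, in particular on the closed unit disc. -/
def pgf (π : Measure ℕ) (s : ℂ) : ℂ := ∫ k, s ^ k ∂π

/-- Closed form of the PGF of the steady-state delay, frame-synchronous model. -/
def syncDelayPGF (n : ℕ) (lam ε : ℝ) (s : ℂ) : ℂ :=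
  (1 - lam * n / (1 - ε)) *
    (((1 - s) * ((1 - lam) ^ n * (1 - ε * s) ^ n - (1 - lam + (lam - ε) * s) ^ n)) /
      ((1 - (1 - lam) ^ n) * (s * (1 - ε * s) ^ n - (1 - lam + (lam - ε) * s) ^ n)))

/-- Closed form of the PGF of the steady-state delay, frame-asynchronous model. -/
def asyncDelayPGF (n : ℕ) (lam ε : ℝ) (s : ℂ) : ℂ :=
  ((s - 1) * (1 - ε - lam * n) * s ^ n) /
    (s - (1 - lam) - (lam + ε * (s - 1)) * s ^ n)

end PeakAge

end

/-! Both models are one queue: i.i.d. marks say whether a slot carries an arrival (probability `p`),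
and independent i.i.d. rows hold the transmission counts. Marks are the packet counts of frames or
the 0/1 arrivals of channel uses. `p` is `1 - (1 - lam) ^ n` or `lam`; in both cases `p` times the
mean service `M` is `lam * n / (1 - ε) < 1`.

A renewal argument (`map_prevDelay_gap_service`) shows that the delay `D`, the next gap `T` and the
next service `S` are independent, with `T` geometric and `(T, S)` of a fixed law. So delays follow
the Lindley recursion: the new delay is `(D - T)⁺ + S`. Memorylessness of `T` turns this into the
equation `(s - (1 - p)) G'(s) = g(s) (p G(s) + (s - 1) G(1 - p))`, where `g` is the PGF of `S`
(`pgf_lindleyStep`).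

Starting from `0`, the tails of the delay increase and hence converge. Letting `s → 1⁻` in the
equation bounds `G(1 - p)` below by `1 - p * M`, and because `p * M < 1` this forbids any escape of
mass to infinity (`exists_stationary`). The limit is therefore a stationary law, for which the same
passage to the limit gives `G(1 - p) = 1 - p * M`. This fixes the only unknown, so the equation can
be solved for `G` (`pgf_stationary`).

The peak age has the law of `max D T + S`; integrating out `T` expresses its PGF through `G(s)`,
`G((1 - p) s)` and `g(s)` (`pgf_peakLaw`). Inserting the service PGFs gives the closed forms. -/

namespace PeakAge

/-! ### Geometric laws on the positive integers -/

section Geometric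

variable {p : ℝ} {γ : Measure ℕ}

/-- `γ` is the geometric law on `{1, 2, …}` with success probability `p`. -/
structure IsGeometric (p : ℝ) (γ : Measure ℕ) : Prop where
  isProbabilityMeasure : IsProbabilityMeasure γ
  pos : 0 < p
  lt_one : p < 1
  apply_succ : ∀ k, γ.real {k + 1} = p * (1 - p) ^ k

/-- The masses prescribed on the positive integers already add up to `1`. -/
theorem IsGeometric.apply_zero (h : IsGeometric p γ) : γ {0} = 0 := by
  have := h.isProbabilityMeasure
  have h1 : HasSum (fun k : ℕ => γ.real {k}) 1 := by
    have h2 := hasSum_integral_measure (μ := fun k : ℕ => γ {k} • Measure.dirac k)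
      (f := fun _ : ℕ => (1 : ℝ)) (by rw [Measure.sum_smul_dirac]; exact integrable_const _)
    rw [Measure.sum_smul_dirac] at h2
    simpa [measureReal_def] using h2
  have h3 : HasSum (fun k : ℕ => γ.real {k + 1}) 1 := by
    simp_rw [h.apply_succ]
    have := (hasSum_geometric_of_lt_one (r := 1 - p) (by linarith [h.lt_one])
      (by linarith [h.pos])).mul_left p
    simpa [h.pos.ne'] using this
  have h4 := (hasSum_nat_add_iff (f := fun k : ℕ => γ.real {k}) 1).1 h3
  have h5 := h1.unique h4
  simp only [Finset.range_one, Finset.sum_singleton] at h5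
  have h6 : γ.real {0} = 0 := by linarith
  exact (measureReal_eq_zero_iff).1 h6

/-- Memorylessness: after a failed first trial the law starts afresh, shifted by one. The geometric
integrals below come from this decomposition, with induction on `d` where a second variable is
present. -/
theorem IsGeometric.eq_add (h : IsGeometric p γ) :
    γ = ENNReal.ofReal p • Measure.dirac 1 + ENNReal.ofReal (1 - p) • γ.map (· + 1) := by
  have := h.isProbabilityMeasure
  have hp := h.pos
  have hq : 0 ≤ 1 - p := by linarith [h.lt_one]
  have hs : ∀ k, γ {k + 1} = ENNReal.ofReal (p * (1 - p) ^ k) := fun k => by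
    rw [← h.apply_succ, ofReal_measureReal]
  refine Measure.ext_of_singleton fun k => ?_
  rw [Measure.add_apply, Measure.smul_apply, Measure.smul_apply,
    Measure.map_apply (by fun_prop) (by simp), Measure.dirac_apply' _ (by simp)]
  match k with
  | 0 => simp [h.apply_zero, Set.preimage]
  | 1 =>
    have h1 : (fun x : ℕ => x + 1) ⁻¹' {1} = {0} := by ext; simp
    have h2 := hs 0
    simp only [zero_add, pow_zero, mul_one] at h2
    simp [h1, h.apply_zero, h2]
  | k + 2 =>
    have h1 : (fun x : ℕ => x + 1) ⁻¹' {k + 2} = {k + 1} := by ext; simp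
    rw [h1, hs, hs k]
    simp only [smul_eq_mul]
    rw [Set.indicator_of_notMem (by simp), ← ENNReal.ofReal_mul hq]
    simp only [mul_zero, zero_add]
    congr 1
    ring

theorem IsGeometric.integral_eq {E : Type*} [NormedAddCommGroup E] [NormedSpace ℝ E]
    [CompleteSpace E] (h : IsGeometric p γ) {f : ℕ → E} (hf : Integrable f γ) :
    ∫ t, f t ∂γ = p • f 1 + (1 - p) • ∫ t, f (t + 1) ∂γ := by
  have hf' := hf
  rw [h.eq_add, integrable_add_measure] at hf'
  conv_lhs => rw [h.eq_add]
  rw [integral_add_measure hf'.1 hf'.2, integral_smul_measure, integral_smul_measure,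
    integral_dirac, integral_map (by fun_prop) (by fun_prop),
    ENNReal.toReal_ofReal h.pos.le, ENNReal.toReal_ofReal (by linarith [h.lt_one])]

variable {𝕜 : Type*} [RCLike 𝕜] {s : 𝕜}

theorem norm_pow_le_max_one_pow {a b : ℕ} (hab : a ≤ b) : ‖s ^ a‖ ≤ max 1 ‖s‖ ^ b := by
  rw [norm_pow]
  calc ‖s‖ ^ a ≤ max 1 ‖s‖ ^ a := by gcongr; exact le_max_right _ _
    _ ≤ max 1 ‖s‖ ^ b := pow_le_pow_right₀ (le_max_left _ _) hab

theorem IsGeometric.integrable_pow_sub (h : IsGeometric p γ) (d : ℕ) :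
    Integrable (fun t : ℕ => s ^ (d - t)) γ := by
  have := h.isProbabilityMeasure
  exact Integrable.of_bound (by fun_prop) (max 1 ‖s‖ ^ d)
    (ae_of_all _ fun t => norm_pow_le_max_one_pow (Nat.sub_le _ _))

/-- Kept free of division so that it also holds at `s = 1 - p`. Truncated subtraction keeps the
exponent in `[0, d]`, so every `s` is allowed. -/
theorem IsGeometric.integral_pow_sub (h : IsGeometric p γ) (d : ℕ) :
    (s - (1 - p : ℝ)) * ∫ t : ℕ, s ^ (d - t) ∂γ = p * s ^ d + (s - 1) * ((1 - p : ℝ) : 𝕜) ^ d := by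
  have := h.isProbabilityMeasure
  induction d with
  | zero =>
    simp only [Nat.zero_sub, pow_zero, integral_const, probReal_univ, one_smul]
    push_cast
    ring
  | succ d ih =>
    rw [h.integral_eq (h.integrable_pow_sub _)]
    simp only [Nat.add_sub_add_right, Nat.add_sub_cancel, RCLike.real_smul_eq_coe_mul]
    rw [mul_add, mul_left_comm _ (((1 - p : ℝ)) : 𝕜), ih]
    push_cast
    ring

/-- The integral `I` of `‖s‖ ^ t` satisfies `I = p * ‖s‖ + (1 - p) * ‖s‖ * I`; a ratio of at least
`1` would give `I ≥ p * ‖s‖ + I`. Thus integrability alone keeps the denominator `1 - (1 - p) * s`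
away from zero. -/
theorem IsGeometric.mul_norm_lt_one (h : IsGeometric p γ)
    (hs : Integrable (fun t : ℕ => s ^ t) γ) : (1 - p) * ‖s‖ < 1 := by
  have := h.isProbabilityMeasure
  rcases eq_or_ne s 0 with rfl | hs0
  · simp
  have h1 := hs.norm
  simp only [norm_pow] at h1
  have h2 := h.integral_eq h1
  simp only [pow_succ, smul_eq_mul, integral_mul_const] at h2
  have hpos : 0 < p * ‖s‖ := mul_pos h.pos (norm_pos_iff.2 hs0)
  have hI : 0 ≤ ∫ t : ℕ, ‖s‖ ^ t ∂γ := integral_nonneg fun t => by positivity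
  by_contra hc
  push Not at hc
  nlinarith

theorem IsGeometric.one_sub_mul_ne_zero (h : IsGeometric p γ)
    (hs : Integrable (fun t : ℕ => s ^ t) γ) : 1 - ((1 - p : ℝ) : 𝕜) * s ≠ 0 := by
  intro h0
  have h1 := h.mul_norm_lt_one hs
  have h2 : ‖((1 - p : ℝ) : 𝕜) * s‖ = 1 := by rw [← sub_eq_zero.1 h0, norm_one]
  rw [norm_mul, RCLike.norm_ofReal, abs_of_nonneg (by linarith [h.lt_one])] at h2
  linarith

theorem integrable_pow_max {γ : Measure ℕ} [IsProbabilityMeasure γ]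
    (hs : Integrable (fun t : ℕ => s ^ t) γ) (d : ℕ) : Integrable (fun t : ℕ => s ^ max d t) γ := by
  refine ((integrable_const ‖s ^ d‖).add hs.norm).mono' (by fun_prop) (ae_of_all _ fun t => ?_)
  simp only [Pi.add_apply]
  rcases le_total d t with hdt | hdt
  · rw [max_eq_right hdt]; linarith [norm_nonneg (s ^ d)]
  · rw [max_eq_left hdt]; linarith [norm_nonneg (s ^ t)]

theorem IsGeometric.integral_pow (h : IsGeometric p γ)
    (hs : Integrable (fun t : ℕ => s ^ t) γ) :
    (1 - ((1 - p : ℝ) : 𝕜) * s) * ∫ t : ℕ, s ^ t ∂γ = p * s := by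
  have h2 := h.integral_eq hs
  simp only [pow_succ, RCLike.real_smul_eq_coe_mul, integral_mul_const] at h2
  linear_combination h2

theorem IsGeometric.integral_pow_max (h : IsGeometric p γ)
    (hs : Integrable (fun t : ℕ => s ^ t) γ) (d : ℕ) :
    ∫ t : ℕ, s ^ max d t ∂γ =
      s ^ d - (((1 - p : ℝ) : 𝕜) * s) ^ d * ((1 - s) / (1 - ((1 - p : ℝ) : 𝕜) * s)) := by
  have := h.isProbabilityMeasure
  have hne := h.one_sub_mul_ne_zero hs
  induction d with
  | zero =>
    simp only [Nat.zero_max, pow_zero]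
    have h2 := h.integral_pow hs
    rw [one_mul, eq_sub_iff_add_eq, ← mul_right_inj' hne, mul_add, h2, mul_div_cancel₀ _ hne]
    push_cast
    ring
  | succ d ih =>
    rw [h.integral_eq (integrable_pow_max hs _)]
    have h1 : ∀ t : ℕ, s ^ max (d + 1) (t + 1) = s ^ max d t * s := fun t => by
      rw [max_add_add_right, pow_succ]
    simp only [h1, integral_mul_const, ih, RCLike.real_smul_eq_coe_mul]
    rw [max_eq_left (by omega)]
    push_cast
    ring

end Geometric

/-! ### The Lindley recursion for delays -/

section Lindley

/-- The law of `(D - T) + S` (truncated subtraction) for independent `D ∼ μ`, `T ∼ γ`, `S ∼ σ`. -/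
noncomputable def lindleyStep (γ σ μ : Measure ℕ) : Measure ℕ :=
  (μ.prod (γ.prod σ)).map fun x => x.1 - x.2.1 + x.2.2

/-- The law of the delay after `m` customers. -/
noncomputable def lindleyLaw (γ σ : Measure ℕ) : ℕ → Measure ℕ
  | 0 => Measure.dirac 0
  | m + 1 => lindleyStep γ σ (lindleyLaw γ σ m)

/-- The law of `max D T + S` for independent `D ∼ μ`, `T ∼ γ`, `S ∼ σ`. -/
noncomputable def peakLaw (γ σ μ : Measure ℕ) : Measure ℕ :=
  (μ.prod (γ.prod σ)).map fun x => max x.1 x.2.1 + x.2.2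

variable {γ σ μ : Measure ℕ}

/-- Given `(T, S)`, a tail event of the new delay is a tail event of the old one. Stochastic
monotonicity and continuity of the step thus reduce to statements about tails under an integral. -/
theorem lindleyStep_apply [SFinite γ] [SFinite σ] [SFinite μ] (k : ℕ) :
    lindleyStep γ σ μ {j | k ≤ j} =
    ∫⁻ y, μ {d | (if k ≤ y.2 then 0 else k - y.2 + y.1) ≤ d} ∂γ.prod σ := by
  rw [lindleyStep, Measure.map_apply (by fun_prop) (by measurability),
    Measure.prod_apply_symm (by measurability)]
  refine lintegral_congr fun y => ?_
  congr 1
  ext d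
  simp only [Set.mem_preimage, Set.mem_ofPred_eq]
  split_ifs <;> omega

theorem peakLaw_apply [SFinite γ] [SFinite σ] [SFinite μ] (k : ℕ) : peakLaw γ σ μ {j | k ≤ j} =
    ∫⁻ y, μ {d | (if k ≤ y.1 + y.2 then 0 else k - y.2) ≤ d} ∂γ.prod σ := by
  rw [peakLaw, Measure.map_apply (by fun_prop) (by measurability),
    Measure.prod_apply_symm (by measurability)]
  refine lintegral_congr fun y => ?_
  congr 1
  ext d
  simp only [Set.mem_preimage, Set.mem_ofPred_eq]
  split_ifs <;> omega

theorem lindleyStep_mono {μ ν : Measure ℕ} [SFinite γ] [SFinite σ] [SFinite μ] [SFinite ν]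
    (h : ∀ k, μ {j | k ≤ j} ≤ ν {j | k ≤ j}) (k : ℕ) :
    lindleyStep γ σ μ {j | k ≤ j} ≤ lindleyStep γ σ ν {j | k ≤ j} := by
  rw [lindleyStep_apply, lindleyStep_apply]
  exact lintegral_mono fun y => h _

instance [IsProbabilityMeasure γ] [IsProbabilityMeasure σ] [IsProbabilityMeasure μ] :
    IsProbabilityMeasure (lindleyStep γ σ μ) :=
  Measure.isProbabilityMeasure_map (by fun_prop)

variable [IsProbabilityMeasure γ] [IsProbabilityMeasure σ]

instance [IsProbabilityMeasure μ] : IsProbabilityMeasure (peakLaw γ σ μ) :=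
  Measure.isProbabilityMeasure_map (by fun_prop)

instance (m : ℕ) : IsProbabilityMeasure (lindleyLaw γ σ m) := by
  induction m with
  | zero => exact Measure.dirac.isProbabilityMeasure
  | succ m ih => exact inferInstanceAs (IsProbabilityMeasure (lindleyStep γ σ _))

/-- The starting law, a point mass at `0`, is stochastically smallest, and the step preserves the
stochastic order. -/
theorem lindleyLaw_mono (k : ℕ) : Monotone fun m => lindleyLaw γ σ m {j | k ≤ j} := by
  refine monotone_nat_of_le_succ fun m => ?_
  induction m generalizing k with
  | zero =>
    rcases k with _ | k
    · simp
    · simp [lindleyLaw]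
  | succ m ih => exact lindleyStep_mono ih k

section Convergence

variable {μs : ℕ → Measure ℕ} [∀ m, IsProbabilityMeasure (μs m)]

theorem tendsto_lindleyStep
    (h : ∀ k, Tendsto (fun m => μs m {j | k ≤ j}) atTop (𝓝 (μ {j | k ≤ j}))) (k : ℕ) :
    Tendsto (fun m => lindleyStep γ σ (μs m) {j | k ≤ j}) atTop
      (𝓝 (lindleyStep γ σ μ {j | k ≤ j})) := by
  simp_rw [lindleyStep_apply]
  exact tendsto_lintegral_of_dominated_convergence (fun _ => 1) (fun m => measurable_of_countable _)
    (fun m => ae_of_all _ fun y => prob_le_one) (by simp) (ae_of_all _ fun y => h _)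

theorem tendsto_peakLaw
    (h : ∀ k, Tendsto (fun m => μs m {j | k ≤ j}) atTop (𝓝 (μ {j | k ≤ j}))) (k : ℕ) :
    Tendsto (fun m => peakLaw γ σ (μs m) {j | k ≤ j}) atTop (𝓝 (peakLaw γ σ μ {j | k ≤ j})) := by
  simp_rw [peakLaw_apply]
  exact tendsto_lintegral_of_dominated_convergence (fun _ => 1) (fun m => measurable_of_countable _)
    (fun m => ae_of_all _ fun y => prob_le_one) (by simp) (ae_of_all _ fun y => h _)

end Convergence

theorem measureReal_singleton_eq_sub (μ : Measure ℕ) [IsFiniteMeasure μ] (k : ℕ) :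
    μ.real {k} = μ.real {j | k ≤ j} - μ.real {j | k + 1 ≤ j} := by
  rw [← measureReal_sdiff (by intro j; simp; omega) (by measurability)]
  congr 1
  ext j
  simp
  omega

theorem ext_of_tails {μ ν : Measure ℕ} [IsFiniteMeasure μ] [IsFiniteMeasure ν]
    (h : ∀ k, μ {j | k ≤ j} = ν {j | k ≤ j}) : μ = ν := by
  refine Measure.ext_of_singleton fun k => ?_
  rw [← ENNReal.toReal_eq_toReal_iff' (by finiteness) (by finiteness)]
  change μ.real _ = ν.real _
  rw [measureReal_singleton_eq_sub, measureReal_singleton_eq_sub]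
  simp only [measureReal_def, h]

theorem measureReal_tail (μ : Measure ℕ) [IsProbabilityMeasure μ] (k : ℕ) :
    μ.real {j | k ≤ j} = 1 - ∑ j ∈ Finset.range k, μ.real {j} := by
  induction k with
  | zero => simp
  | succ k ih =>
    rw [Finset.sum_range_succ]
    linarith [measureReal_singleton_eq_sub μ k]

/-! ### Generating functions -/

variable {𝕜 : Type*} [RCLike 𝕜] {s : 𝕜}

theorem integrable_pow_of_norm_le_one {μ : Measure ℕ} [IsFiniteMeasure μ] (hs : ‖s‖ ≤ 1) :
    Integrable (fun k : ℕ => s ^ k) μ :=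
  Integrable.of_bound (by fun_prop) 1 (ae_of_all _ fun k => by
    rw [norm_pow]; exact pow_le_one₀ (norm_nonneg _) hs)

/-- If `s ^ Z` is integrable and `f ≤ Z`, then `s ^ f` is integrable. -/
theorem integrable_pow_of_le {Ω : Type*} [MeasurableSpace Ω] {P : Measure Ω}
    [IsFiniteMeasure P] {f Z : Ω → ℕ} (hf : AEMeasurable f P) (hfZ : ∀ᵐ ω ∂P, f ω ≤ Z ω)
    (hs : Integrable (fun ω => s ^ Z ω) P) : Integrable (fun ω => s ^ f ω) P := by
  have hm : AEStronglyMeasurable (fun ω => s ^ f ω) P :=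
    ((measurable_of_countable fun k : ℕ => s ^ k).comp_aemeasurable hf).aestronglyMeasurable
  refine ((integrable_const (1 : ℝ)).add hs.norm).mono' hm ?_
  filter_upwards [hfZ] with ω hω
  simp only [Pi.add_apply, norm_pow]
  rcases le_total ‖s‖ 1 with h1 | h1
  · have := pow_le_one₀ (n := f ω) (norm_nonneg s) h1
    have : 0 ≤ ‖s‖ ^ Z ω := by positivity
    linarith
  · have := pow_le_pow_right₀ h1 hω
    linarith

theorem integrable_pow_snd_of_lindleyStep [IsProbabilityMeasure μ]
    (hs : Integrable (fun k : ℕ => s ^ k) (lindleyStep γ σ μ)) :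
    Integrable (fun k : ℕ => s ^ k) σ := by
  rw [lindleyStep, integrable_map_measure (by fun_prop) (by fun_prop)] at hs
  have h1 : Integrable (fun x : ℕ × ℕ × ℕ => s ^ x.2.2) (μ.prod (γ.prod σ)) :=
    integrable_pow_of_le (by fun_prop) (ae_of_all _ fun x => Nat.le_add_left _ _) hs
  have h2 : Integrable (fun y : ℕ × ℕ => s ^ y.2) (γ.prod σ) :=
    (Integrable.comp_snd_iff (IsProbabilityMeasure.ne_zero μ)).1 h1
  exact (Integrable.comp_snd_iff (f := fun k : ℕ => s ^ k) (IsProbabilityMeasure.ne_zero γ)).1 h2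

/-- The functional equation of the peak age. -/
theorem pgf_peakLaw {p : ℝ} (hγ : IsGeometric p γ) [IsProbabilityMeasure μ]
    (hs : Integrable (fun k : ℕ => s ^ k) (peakLaw γ σ μ)) :
    Integrable (fun k : ℕ => s ^ k) μ ∧ Integrable (fun k : ℕ => s ^ k) σ ∧
    (1 - p) * ‖s‖ < 1 ∧ 1 - ((1 - p : ℝ) : 𝕜) * s ≠ 0 ∧
    ∫ k : ℕ, s ^ k ∂(peakLaw γ σ μ) = (∫ k : ℕ, s ^ k ∂σ) * (∫ k : ℕ, s ^ k ∂μ -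
      (1 - s) * (∫ k : ℕ, (((1 - p : ℝ) : 𝕜) * s) ^ k ∂μ) / (1 - ((1 - p : ℝ) : 𝕜) * s)) := by
  have hs' := hs
  rw [peakLaw, integrable_map_measure (by fun_prop) (by fun_prop)] at hs
  -- Integrability of `s ^ (max D T + S)` passes to any smaller exponent, in particular to `D`, `T`
  -- and `S` separately, also when `‖s‖ > 1`.
  have hsub : ∀ {f : ℕ × ℕ × ℕ → ℕ}, (∀ x, f x ≤ max x.1 x.2.1 + x.2.2) →
      Integrable (fun x => s ^ f x) (μ.prod (γ.prod σ)) := fun hf =>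
    integrable_pow_of_le (measurable_of_countable _).aemeasurable (ae_of_all _ hf) hs
  have hμ : Integrable (fun k : ℕ => s ^ k) μ :=
    (Integrable.comp_fst_iff (f := fun k : ℕ => s ^ k) (IsProbabilityMeasure.ne_zero (γ.prod σ))).1
      (hsub fun x => by omega)
  have hγσ : ∀ {f : ℕ × ℕ → ℕ}, (∀ y, f y ≤ y.1 + y.2) →
      Integrable (fun y => s ^ f y) (γ.prod σ) := fun {f} hf =>
    (Integrable.comp_snd_iff (f := fun y => s ^ f y) (IsProbabilityMeasure.ne_zero μ)).1
      (hsub fun x => (hf x.2).trans (by omega))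
  have hsγ : Integrable (fun k : ℕ => s ^ k) γ :=
    (Integrable.comp_fst_iff (f := fun k : ℕ => s ^ k) (IsProbabilityMeasure.ne_zero σ)).1
      (hγσ fun y => by omega)
  have hsσ : Integrable (fun k : ℕ => s ^ k) σ :=
    (Integrable.comp_snd_iff (f := fun k : ℕ => s ^ k) (IsProbabilityMeasure.ne_zero γ)).1
      (hγσ fun y => by omega)
  have hlt := hγ.mul_norm_lt_one hsγ
  have hqs : Integrable (fun k : ℕ => (((1 - p : ℝ) : 𝕜) * s) ^ k) μ :=
    integrable_pow_of_norm_le_one (by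
      rw [norm_mul, RCLike.norm_ofReal, abs_of_nonneg (by linarith [hγ.lt_one])]
      exact hlt.le)
  refine ⟨hμ, hsσ, hlt, hγ.one_sub_mul_ne_zero hsγ, ?_⟩
  have hμγ : Integrable (fun x : ℕ × ℕ => s ^ max x.1 x.2) (μ.prod γ) := by
    refine ((hμ.comp_fst γ).norm.add (hsγ.comp_snd μ).norm).mono' (by fun_prop)
      (ae_of_all _ fun x => ?_)
    simp only [Pi.add_apply]
    rcases le_total x.1 x.2 with h | h
    · rw [max_eq_right h]; linarith [norm_nonneg (s ^ x.1)]
    · rw [max_eq_left h]; linarith [norm_nonneg (s ^ x.2)]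
  have h1 : ∫ k : ℕ, s ^ k ∂(peakLaw γ σ μ) =
      (∫ x : ℕ × ℕ, s ^ max x.1 x.2 ∂μ.prod γ) * ∫ k : ℕ, s ^ k ∂σ := by
    rw [peakLaw, integral_map (by fun_prop) (by fun_prop), ← integral_prod_mul,
      ← Measure.prodAssoc_prod, integral_map (by fun_prop) (by fun_prop)]
    simp only [pow_add]
    rfl
  -- Integrate out `T` for fixed `d`; the geometric tail produces the second argument `(1 - p) * s`.
  have h2 : ∫ x : ℕ × ℕ, s ^ max x.1 x.2 ∂μ.prod γ = ∫ d : ℕ, (s ^ d -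
      (((1 - p : ℝ) : 𝕜) * s) ^ d * ((1 - s) / (1 - ((1 - p : ℝ) : 𝕜) * s))) ∂μ := by
    rw [integral_prod _ hμγ]
    exact integral_congr_ae (ae_of_all _ fun d => hγ.integral_pow_max hsγ d)
  rw [h1, h2, integral_sub hμ (hqs.mul_const _), integral_mul_const, mul_comm]
  ring

end Lindley

/-- The functional equation of the delay recursion. -/
theorem pgf_lindleyStep {𝕜 : Type*} [RCLike 𝕜] {s : 𝕜} {γ σ μ : Measure ℕ}
    [IsProbabilityMeasure γ] [SFinite σ] {p : ℝ} (hγ : IsGeometric p γ) [IsProbabilityMeasure μ]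
    (hμ : Integrable (fun k : ℕ => s ^ k) μ) :
    (s - (1 - p : ℝ)) * ∫ k : ℕ, s ^ k ∂(lindleyStep γ σ μ) =
      (∫ k : ℕ, s ^ k ∂σ) *
        (p * ∫ k : ℕ, s ^ k ∂μ + (s - 1) * ∫ k : ℕ, ((1 - p : ℝ) : 𝕜) ^ k ∂μ) := by
  have hq : Integrable (fun k : ℕ => ((1 - p : ℝ) : 𝕜) ^ k) μ :=
    integrable_pow_of_norm_le_one (by
      rw [RCLike.norm_ofReal, abs_le]; constructor <;> linarith [hγ.pos, hγ.lt_one])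
  have hμγ : Integrable (fun x : ℕ × ℕ => s ^ (x.1 - x.2)) (μ.prod γ) :=
    integrable_pow_of_le (by fun_prop) (ae_of_all _ fun x => Nat.sub_le _ _) (hμ.comp_fst γ)
  have h1 : ∫ k : ℕ, s ^ k ∂(lindleyStep γ σ μ) =
      (∫ x : ℕ × ℕ, s ^ (x.1 - x.2) ∂μ.prod γ) * ∫ k : ℕ, s ^ k ∂σ := by
    rw [lindleyStep, integral_map (by fun_prop) (by fun_prop), ← integral_prod_mul,
      ← Measure.prodAssoc_prod, integral_map (by fun_prop) (by fun_prop)]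
    simp only [pow_add]
    rfl
  have h2 : (s - (1 - p : ℝ)) * ∫ x : ℕ × ℕ, s ^ (x.1 - x.2) ∂μ.prod γ =
      ∫ d : ℕ, (p * s ^ d + (s - 1) * ((1 - p : ℝ) : 𝕜) ^ d) ∂μ := by
    rw [integral_prod _ hμγ, ← integral_const_mul]
    exact integral_congr_ae (ae_of_all _ fun d => hγ.integral_pow_sub d)
  rw [h1, ← mul_assoc, h2, mul_comm, integral_add (hμ.const_mul _) (hq.const_mul _),
    integral_const_mul, integral_const_mul]

/-! ### Existence, normalization and generating function of the stationary delay -/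

section Stationary

theorem summable_tails (μ : Measure ℕ) [IsProbabilityMeasure μ] {s : ℝ} (h0 : 0 ≤ s) (h1 : s < 1) :
    Summable fun j : ℕ => μ.real {i | j + 1 ≤ i} * s ^ j :=
  (summable_geometric_of_lt_one h0 h1).of_nonneg_of_le (fun j => by positivity) fun j =>
    mul_le_of_le_one_left (by positivity) measureReal_le_one

/-- Summation by parts. In this form the PGF is visibly antitone in the tails and continuous under
their pointwise convergence. -/
theorem pgf_eq_tails (μ : Measure ℕ) [IsProbabilityMeasure μ] {s : ℝ} (h0 : 0 ≤ s) (h1 : s < 1) :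
    ∫ k : ℕ, s ^ k ∂μ = 1 - (1 - s) * ∑' j : ℕ, μ.real {i | j + 1 ≤ i} * s ^ j := by
  have hs := summable_tails μ h0 h1
  have hs' : Summable fun j : ℕ => μ.real {i | j ≤ i} * s ^ j :=
    (summable_geometric_of_lt_one h0 h1).of_nonneg_of_le (fun j => by positivity) fun j =>
      mul_le_of_le_one_left (by positivity) measureReal_le_one
  have h2 := hs'.tsum_eq_zero_add
  rw [integral_countable (integrable_pow_of_norm_le_one
    (by rw [Real.norm_of_nonneg h0]; exact h1.le))]
  simp_rw [measureReal_singleton_eq_sub, smul_eq_mul, sub_mul]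
  rw [hs'.tsum_sub hs, h2]
  have h3 : ∀ j : ℕ, μ.real {i | j + 1 ≤ i} * s ^ (j + 1) =
      s * (μ.real {i | j + 1 ≤ i} * s ^ j) := fun j => by ring
  simp_rw [h3, tsum_mul_left]
  simp
  ring

theorem pgf_anti {μ ν : Measure ℕ} [IsProbabilityMeasure μ] [IsProbabilityMeasure ν]
    (h : ∀ k, μ {j | k ≤ j} ≤ ν {j | k ≤ j}) {s : ℝ} (h0 : 0 ≤ s) (h1 : s < 1) :
    ∫ k : ℕ, s ^ k ∂ν ≤ ∫ k : ℕ, s ^ k ∂μ := by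
  rw [pgf_eq_tails μ h0 h1, pgf_eq_tails ν h0 h1]
  have : ∑' j : ℕ, μ.real {i | j + 1 ≤ i} * s ^ j ≤ ∑' j : ℕ, ν.real {i | j + 1 ≤ i} * s ^ j :=
    (summable_tails μ h0 h1).tsum_le_tsum (fun j => mul_le_mul_of_nonneg_right
      (ENNReal.toReal_mono (by finiteness) (h _)) (by positivity)) (summable_tails ν h0 h1)
  have := mul_le_mul_of_nonneg_left this (by linarith : 0 ≤ 1 - s)
  linarith

/-- The limit tails `l` need not belong to a probability measure: mass may be lost at infinity, and
excluding this comes later. -/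
theorem tendsto_pgf_of_tails {μs : ℕ → Measure ℕ} [∀ m, IsProbabilityMeasure (μs m)] {l : ℕ → ℝ}
    (h : ∀ k, Tendsto (fun m => (μs m).real {j | k ≤ j}) atTop (𝓝 (l k))) {s : ℝ} (h0 : 0 ≤ s)
    (h1 : s < 1) : Tendsto (fun m => ∫ k : ℕ, s ^ k ∂(μs m)) atTop
      (𝓝 (1 - (1 - s) * ∑' j : ℕ, l (j + 1) * s ^ j)) := by
  simp_rw [fun m => pgf_eq_tails (μs m) h0 h1]
  refine tendsto_const_nhds.sub (tendsto_const_nhds.mul ?_)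
  refine tendsto_tsum_of_dominated_convergence (summable_geometric_of_lt_one h0 h1)
    (fun j => (h _).mul_const _) (Eventually.of_forall fun m j => ?_)
  rw [Real.norm_of_nonneg (by positivity)]
  exact mul_le_of_le_one_left (by positivity) measureReal_le_one

theorem eventually_nhdsLT_one {a : ℝ} (ha : a < 1) : ∀ᶠ s : ℝ in 𝓝[<] 1, a < s ∧ s < 1 :=
  Ioo_mem_nhdsLT ha

theorem tendsto_pgf_one (μ : Measure ℕ) [IsProbabilityMeasure μ] :
    Tendsto (fun s : ℝ => ∫ k : ℕ, s ^ k ∂μ) (𝓝[<] 1) (𝓝 1) := by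
  have h : Tendsto (fun s : ℝ => ∫ k : ℕ, s ^ k ∂μ) (𝓝[<] 1) (𝓝 (∫ k : ℕ, (1 : ℝ) ^ k ∂μ)) := by
    refine tendsto_integral_filter_of_dominated_convergence (fun _ => 1)
      (Eventually.of_forall fun s => by fun_prop) ?_ (integrable_const _)
      (ae_of_all _ fun k => ((continuous_pow k).tendsto 1).mono_left nhdsWithin_le_nhds)
    filter_upwards [eventually_nhdsLT_one (zero_lt_one)] with s hs
    refine ae_of_all _ fun k => ?_
    rw [norm_pow, Real.norm_of_nonneg hs.1.le]
    exact pow_le_one₀ hs.1.le hs.2.le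
  simpa using h

variable {p M : ℝ} {γ σ : Measure ℕ} [IsProbabilityMeasure γ] [IsProbabilityMeasure σ]

/-- A rescaled form of the functional equation of a stationary law. -/
theorem mul_one_sub_eq {p s a g gq : ℝ} (hs : s < 1)
    (h : (s - (1 - p)) * a = g * (p * a + (s - 1) * gq)) :
    a * (1 - p * ((1 - g) / (1 - s))) = g * gq := by
  have : 1 - s ≠ 0 := by linarith
  field_simp
  linear_combination -h

/-- If one step increases the tails, it decreases the PGF, and the functional equation becomes an
inequality between `a * (1 - p * (1 - g) / (1 - s))` and `g * G(1 - p)`. The bound is its limit as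
`s → 1⁻`; only `s > 1 - p` is used, so that the factor `s - (1 - p)` keeps the direction. -/
theorem le_pgf_of_tails_le (hγ : IsGeometric p γ)
    (hM : Tendsto (fun s : ℝ => (1 - ∫ k : ℕ, s ^ k ∂σ) / (1 - s)) (𝓝[<] 1) (𝓝 M))
    {μ : Measure ℕ} [IsProbabilityMeasure μ]
    (h : ∀ k, μ {j | k ≤ j} ≤ lindleyStep γ σ μ {j | k ≤ j}) :
    1 - p * M ≤ ∫ k : ℕ, (1 - p) ^ k ∂μ := by
  have h1 := (tendsto_pgf_one μ).mul ((hM.const_mul p).const_sub 1)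
  have h2 := (tendsto_pgf_one σ).mul_const (∫ k : ℕ, (1 - p) ^ k ∂μ)
  rw [one_mul] at h1 h2
  refine le_of_tendsto_of_tendsto h1 h2 ?_
  filter_upwards [eventually_nhdsLT_one (show 1 - p < 1 by linarith [hγ.pos])] with s hs
  have h0 : 0 ≤ s := by linarith [hγ.lt_one]
  have h3 := pgf_lindleyStep (σ := σ) (s := s) hγ (μ := μ)
    (integrable_pow_of_norm_le_one (by rw [Real.norm_of_nonneg h0]; exact hs.2.le))
  simp only [RCLike.ofReal_real_eq_id, id_eq] at h3
  have h4 := mul_le_mul_of_nonneg_left (pgf_anti h h0 hs.2) (by linarith : 0 ≤ s - (1 - p))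
  rw [h3] at h4
  set a := ∫ k : ℕ, s ^ k ∂μ
  set g := ∫ k : ℕ, s ^ k ∂σ
  have h5 : 0 < 1 - s := by linarith
  have h6 : a * (1 - p * ((1 - g) / (1 - s))) = a * ((1 - s) - p * (1 - g)) / (1 - s) := by
    field_simp
  rw [h6, div_le_iff₀ h5]
  linarith

/-- A stable Lindley recursion started at `0` converges to a stationary law. -/
theorem exists_stationary (hγ : IsGeometric p γ)
    (hM : Tendsto (fun s : ℝ => (1 - ∫ k : ℕ, s ^ k ∂σ) / (1 - s)) (𝓝[<] 1) (𝓝 M))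
    (hpM : p * M < 1) : ∃ π : Measure ℕ, IsProbabilityMeasure π ∧
      (∀ k, Tendsto (fun m => lindleyLaw γ σ m {j | k ≤ j}) atTop (𝓝 (π {j | k ≤ j}))) ∧
      lindleyStep γ σ π = π ∧ ∫ k : ℕ, (1 - p) ^ k ∂π = 1 - p * M := by
  have hq0 : 0 ≤ 1 - p := by linarith [hγ.lt_one]
  have hq1 : 1 - p < 1 := by linarith [hγ.pos]
  set l : ℕ → ℝ := fun k => ⨆ m, (lindleyLaw γ σ m).real {j | k ≤ j} with hl
  have hbdd : ∀ k, BddAbove (Set.range fun m => (lindleyLaw γ σ m).real {j | k ≤ j}) := fun k =>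
    ⟨1, by rintro _ ⟨m, rfl⟩; exact measureReal_le_one⟩
  have hlim : ∀ k, Tendsto (fun m => (lindleyLaw γ σ m).real {j | k ≤ j}) atTop (𝓝 (l k)) :=
    fun k => tendsto_atTop_ciSup (fun m m' hmm => ENNReal.toReal_mono (by finiteness)
      (lindleyLaw_mono k hmm)) (hbdd k)
  have hl0 : l 0 = 1 := by simp [hl]
  have hlnn : ∀ k, 0 ≤ l k := fun k => ge_of_tendsto' (hlim k) fun m => measureReal_nonneg
  have hl1 : ∀ k, l k ≤ 1 := fun k => le_of_tendsto' (hlim k) fun m => measureReal_le_one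
  have hanti : Antitone l := antitone_nat_of_succ_le fun k =>
    le_of_tendsto_of_tendsto' (hlim _) (hlim _) fun m => measureReal_mono (by intro j; simp; omega)
  have hinf := tendsto_atTop_ciInf hanti ⟨0, by rintro _ ⟨k, rfl⟩; exact hlnn k⟩
  -- `e` is the mass that escapes to infinity, and `a` below is the PGF of the possibly defective
  -- limit.
  set e := ⨅ k, l k with he
  have hel : ∀ k, e ≤ l k := fun k => ciInf_le ⟨0, by rintro _ ⟨k, rfl⟩; exact hlnn k⟩ k
  have he0 : 0 ≤ e := le_ciInf hlnn
  set a : ℝ → ℝ := fun s => 1 - (1 - s) * ∑' j : ℕ, l (j + 1) * s ^ j with ha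
  have hpgf : ∀ s : ℝ, 0 ≤ s → s < 1 →
      Tendsto (fun m => ∫ k : ℕ, s ^ k ∂(lindleyLaw γ σ m)) atTop (𝓝 (a s)) := fun s h0 h1 =>
    tendsto_pgf_of_tails hlim h0 h1
  have hqa : 1 - p * M ≤ a (1 - p) := ge_of_tendsto' (hpgf _ hq0 hq1) fun m =>
    le_pgf_of_tails_le hγ hM fun k => lindleyLaw_mono k (Nat.le_succ m)
  have hfe : ∀ s : ℝ, 0 ≤ s → s < 1 → (s - (1 - p)) * a s =
      (∫ k : ℕ, s ^ k ∂σ) * (p * a s + (s - 1) * a (1 - p)) := fun s h0 h1 => by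
    refine tendsto_nhds_unique (((hpgf s h0 h1).comp (tendsto_add_atTop_nat 1)).const_mul _) ?_
    refine Tendsto.congr (fun m => ?_) ((((hpgf s h0 h1).const_mul p).add
      ((hpgf _ hq0 hq1).const_mul (s - 1))).const_mul (∫ k : ℕ, s ^ k ∂σ))
    have := pgf_lindleyStep (σ := σ) (s := s) hγ (μ := lindleyLaw γ σ m)
      (integrable_pow_of_norm_le_one (by rw [Real.norm_of_nonneg h0]; exact h1.le))
    simpa [lindleyLaw] using this.symm
  have hale : ∀ s : ℝ, 0 ≤ s → s < 1 → a s ≤ 1 - e := fun s h0 h1 => by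
    have hg := summable_geometric_of_lt_one h0 h1
    have h2 : ∑' j : ℕ, e * s ^ j ≤ ∑' j : ℕ, l (j + 1) * s ^ j :=
      (hg.mul_left e).tsum_le_tsum (fun j => mul_le_mul_of_nonneg_right (hel _) (by positivity))
        (hg.of_nonneg_of_le (fun j => mul_nonneg (hlnn _) (by positivity)) fun j =>
          mul_le_of_le_one_left (by positivity) (hl1 _))
    rw [tsum_mul_left, tsum_geometric_of_lt_one h0 h1] at h2
    have h3 := mul_le_mul_of_nonneg_left h2 (by linarith : 0 ≤ 1 - s)
    have h4 : (1 - s) * (e * (1 - s)⁻¹) = e := by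
      have : 1 - s ≠ 0 := by linarith
      field_simp
    simp only [ha]
    linarith
  have hden := (hM.const_mul p).const_sub 1
  have hdpos := hden.eventually (lt_mem_nhds (show 0 < 1 - p * M by linarith))
  -- As `s → 1⁻`, the lower bound on `a (1 - p)` and the upper bound `a s ≤ 1 - e` give `1 - p * M ≤
  -- (1 - e) * (1 - p * M)`; stability makes the common factor positive.
  have he1 : e = 0 := by
    have h1 := (tendsto_pgf_one σ).mul_const (1 - p * M)
    have h2 := hden.const_mul (1 - e)
    have h3 := le_of_tendsto_of_tendsto h1 h2 (by
      filter_upwards [eventually_nhdsLT_one zero_lt_one, hdpos] with s hs hd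
      have h4 := mul_one_sub_eq hs.2 (hfe s hs.1.le hs.2)
      have h5 : 0 ≤ ∫ k : ℕ, s ^ k ∂σ := integral_nonneg fun k => pow_nonneg hs.1.le k
      calc _ ≤ (∫ k : ℕ, s ^ k ∂σ) * a (1 - p) := mul_le_mul_of_nonneg_left hqa h5
        _ = _ := h4.symm
        _ ≤ _ := mul_le_mul_of_nonneg_right (hale s hs.1.le hs.2) hd.le)
    nlinarith
  have hw : HasSum (fun k => ENNReal.ofReal (l k - l (k + 1))) 1 := by
    have hnn : ∀ k, 0 ≤ l k - l (k + 1) := fun k => sub_nonneg.2 (hanti (Nat.le_succ k))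
    have h1 : HasSum (fun k => l k - l (k + 1)) 1 := by
      rw [hasSum_iff_tendsto_nat_of_nonneg hnn]
      simp_rw [Finset.sum_range_sub', hl0]
      simpa [he1] using hinf.const_sub 1
    have h2 : HasSum (fun k => (l k - l (k + 1)).toNNReal) 1 := by
      rw [← NNReal.hasSum_coe]
      simpa [Real.coe_toNNReal _ (hnn _)] using h1
    exact ENNReal.hasSum_coe.2 h2
  let w : PMF ℕ := ⟨_, hw⟩
  set π : Measure ℕ := w.toMeasure with hπ
  have hsing : ∀ k, π.real {k} = l k - l (k + 1) := fun k => by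
    rw [hπ, measureReal_def, PMF.toMeasure_apply_singleton _ _ (by simp)]
    exact ENNReal.toReal_ofReal (sub_nonneg.2 (hanti (Nat.le_succ k)))
  have htail : ∀ k, π.real {j | k ≤ j} = l k := fun k => by
    rw [measureReal_tail]
    simp_rw [hsing, Finset.sum_range_sub', hl0]
    ring
  have hconv : ∀ k, Tendsto (fun m => lindleyLaw γ σ m {j | k ≤ j}) atTop (𝓝 (π {j | k ≤ j})) :=
    fun k => by
      rw [← ENNReal.tendsto_toReal_iff (by finiteness) (by finiteness)]
      change Tendsto _ _ (𝓝 (π.real _))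
      rw [htail]
      exact hlim k
  have hstat : lindleyStep γ σ π = π := ext_of_tails fun k =>
    tendsto_nhds_unique (tendsto_lindleyStep hconv k) ((hconv k).comp (tendsto_add_atTop_nat 1))
  refine ⟨π, inferInstance, hconv, hstat, ?_⟩
  -- The value at `1 - p` is read off from the functional equation of `π` as `s → 1⁻`.
  have h1 := (tendsto_pgf_one π).mul hden
  have h2 := (tendsto_pgf_one σ).mul_const (∫ k : ℕ, (1 - p) ^ k ∂π)
  rw [one_mul] at h1 h2
  refine tendsto_nhds_unique h2 (Tendsto.congr' ?_ h1)
  filter_upwards [eventually_nhdsLT_one zero_lt_one] with s hs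
  have h3 := pgf_lindleyStep (σ := σ) (s := s) hγ (μ := π)
    (integrable_pow_of_norm_le_one (by rw [Real.norm_of_nonneg hs.1.le]; exact hs.2.le))
  rw [hstat] at h3
  exact mul_one_sub_eq hs.2 (by simpa using h3)

/-- The generating function of a stationary delay. -/
theorem pgf_stationary (hγ : IsGeometric p γ) {π : Measure ℕ} [IsProbabilityMeasure π]
    (hπ : lindleyStep γ σ π = π) (hσ0 : 0 < ∫ k : ℕ, (1 - p) ^ k ∂σ)
    (hq : 0 < ∫ k : ℕ, (1 - p) ^ k ∂π) {s : ℂ} (hs1 : s ≠ 1)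
    (hs : Integrable (fun k : ℕ => s ^ k) π) :
    Integrable (fun k : ℕ => s ^ k) σ ∧
    s - (1 - p : ℝ) - p * ∫ k : ℕ, s ^ k ∂σ ≠ 0 ∧
    ∫ k : ℕ, s ^ k ∂π = ((∫ k : ℕ, (1 - p) ^ k ∂π : ℝ) : ℂ) * (s - 1) * (∫ k : ℕ, s ^ k ∂σ) /
      (s - (1 - p : ℝ) - p * ∫ k : ℕ, s ^ k ∂σ) := by
  have hsσ : Integrable (fun k : ℕ => s ^ k) σ :=
    integrable_pow_snd_of_lindleyStep (γ := γ) (μ := π) (by rwa [hπ])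
  have hfe := pgf_lindleyStep (σ := σ) hγ hs
  have hcast : ∀ μ : Measure ℕ, ∫ k : ℕ, ((1 - p : ℝ) : ℂ) ^ k ∂μ =
      ((∫ k : ℕ, (1 - p) ^ k ∂μ : ℝ) : ℂ) := fun μ => by
    rw [← integral_complex_ofReal]; simp
  simp only [Complex.coe_algebraMap, hπ, hcast] at hfe
  -- If the denominator vanished, the functional equation would force the service PGF to vanish at
  -- `s`, hence `s = 1 - p`; but there that PGF is positive.
  have hne : s - (1 - p : ℝ) - p * ∫ k : ℕ, s ^ k ∂σ ≠ 0 := by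
    intro h0
    have h1 : (∫ k : ℕ, s ^ k ∂σ) * ((s - 1) * ((∫ k : ℕ, (1 - p) ^ k ∂π : ℝ) : ℂ)) = 0 := by
      linear_combination h0 * (∫ k : ℕ, s ^ k ∂π) - hfe
    have h2 : ∫ k : ℕ, s ^ k ∂σ = 0 := by
      rcases mul_eq_zero.1 h1 with h | h
      · exact h
      · rcases mul_eq_zero.1 h with h | h
        · exact absurd (sub_eq_zero.1 h) hs1
        · exact absurd (Complex.ofReal_eq_zero.1 h) hq.ne'
    rw [h2, mul_zero, sub_zero, sub_eq_zero] at h0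
    rw [h0, hcast] at h2
    exact hσ0.ne' (Complex.ofReal_eq_zero.1 h2)
  refine ⟨hsσ, hne, ?_⟩
  rw [eq_div_iff hne]
  linear_combination hfe

end Stationary

/-! ### Queues fed by i.i.d. marks -/

/-! ### Arrival slots as values of `Nat.nth` -/

section CountNth

variable {p : ℕ → Prop}

/-- The number of slots up to and including the one in which customer `m - 1` arrives. -/
noncomputable def slotsUsed (p : ℕ → Prop) : ℕ → ℕ
  | 0 => 0
  | m + 1 => Nat.nth p m + 1

theorem count_slotsUsed [DecidablePred p] (hp : (Set.ofPred p).Infinite) (m : ℕ) :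
    Nat.count p (slotsUsed p m) = m := by
  cases m with
  | zero => simp [slotsUsed]
  | succ m => exact Nat.count_nth_succ_of_infinite hp m

/-- Turns the position of an arrival into a condition on finitely many slots following the previous
arrival. -/
theorem nth_eq_slotsUsed_add_iff (hp : (Set.ofPred p).Infinite) (m t : ℕ) :
    Nat.nth p m = slotsUsed p m + t ↔
      (∀ j < t, ¬p (slotsUsed p m + j)) ∧ p (slotsUsed p m + t) := by
  classical
  have hc := count_slotsUsed hp m
  constructor
  · intro h
    have h1 := Nat.nth_mem_of_infinite hp m
    have h2 := Nat.count_nth_of_infinite hp m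
    rw [h] at h1 h2
    rw [Nat.count_add, hc] at h2
    exact ⟨Nat.count_iff_forall_not.1 (by omega), h1⟩
  · rintro ⟨h1, h2⟩
    have h3 : Nat.count p (slotsUsed p m + t) = m := by
      rw [Nat.count_add, hc, Nat.count_iff_forall_not.2 h1, add_zero]
    conv_lhs => rw [← h3]
    exact Nat.nth_count h2

theorem slotsUsed_le_nth (hp : (Set.ofPred p).Infinite) (m : ℕ) : slotsUsed p m ≤ Nat.nth p m := by
  cases m with
  | zero => exact Nat.zero_le _
  | succ m => exact Nat.nth_strictMono hp (Nat.lt_succ_self m)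

/-- `Nat.nth` defaults to `0` when there are too few arrivals, so only positive values have this
description. Without an infinitude assumption it yields measurability everywhere; the value `0` is
then handled by complement. -/
theorem nth_eq_succ_iff [DecidablePred p] (m c : ℕ) :
    Nat.nth p m = c + 1 ↔ p (c + 1) ∧ Nat.count p (c + 1) = m := by
  constructor
  · intro h
    by_cases hn : ∀ hf : (Set.ofPred p).Finite, m < hf.toFinset.card
    · have h1 := Nat.nth_mem m hn
      have h2 := Nat.count_nth hn
      rw [h] at h1 h2
      exact ⟨h1, h2⟩
    · push Not at hn
      obtain ⟨hf, hm⟩ := hn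
      rw [Nat.nth_of_card_le hf hm] at h
      omega
  · rintro ⟨h1, rfl⟩
    exact Nat.nth_count h1

variable {Ω : Type*} [MeasurableSpace Ω]

theorem measurable_count {p : Ω → ℕ → Prop} [∀ ω, DecidablePred (p ω)]
    (hp : ∀ j, MeasurableSet {ω | p ω j}) (c : ℕ) : Measurable fun ω => Nat.count (p ω) c := by
  induction c with
  | zero => simp
  | succ c ih =>
    simp_rw [Nat.count_succ]
    exact ih.add (Measurable.ite (hp c) measurable_const measurable_const)

theorem measurable_nth {p : Ω → ℕ → Prop} (hp : ∀ j, MeasurableSet {ω | p ω j}) (m : ℕ) :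
    Measurable fun ω => Nat.nth (p ω) m := by
  classical
  have hs : ∀ c, MeasurableSet {ω | Nat.nth (p ω) m = c + 1} := fun c => by
    simp_rw [nth_eq_succ_iff]
    exact (hp _).inter (measurable_count hp (c + 1) (measurableSet_singleton m))
  refine measurable_to_countable' fun c => ?_
  match c with
  | 0 =>
    have : (fun ω => Nat.nth (p ω) m) ⁻¹' {0} = (⋃ c, {ω | Nat.nth (p ω) m = c + 1})ᶜ := by
      ext ω
      simp only [Set.mem_preimage, Set.mem_singleton_iff, Set.mem_compl_iff, Set.mem_iUnion,
        Set.mem_ofPred_eq, not_exists]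
      constructor
      · intro h c; omega
      · intro h
        by_contra h0
        exact h (Nat.nth (p ω) m - 1) (by omega)
    rw [this]
    exact (MeasurableSet.iUnion hs).compl
  | c + 1 => exact hs c

end CountNth

/-! ### Independence of the past and the next arrival -/

section Marks

variable {Ω E : Type*} [MeasurableSpace Ω] [MeasurableSpace E]

/-- Independent i.i.d. sequences `Y` and `V`: a customer arrives in slot `j` iff `Y j` is positive,
and the service time of customer `m` is determined by its mark and by `V m`. -/
structure IsMarkedInput (P : Measure Ω) (Y : ℕ → Ω → ℕ) (V : ℕ → Ω → E) : Prop where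
  measurable_mark : ∀ j, Measurable (Y j)
  measurable_row : ∀ i, Measurable (V i)
  indep_mark : iIndepFun Y P
  indep_row : iIndepFun V P
  indep : IndepFun (fun ω j => Y j ω) (fun ω i => V i ω) P
  map_mark : ∀ j, P.map (Y j) = P.map (Y 0)
  map_row : ∀ i, P.map (V i) = P.map (V 0)

/-- The arrival slot of customer `m`. -/
noncomputable def markArrival (Y : ℕ → Ω → ℕ) (ω : Ω) (m : ℕ) : ℕ := Nat.nth (fun t => 0 < Y t ω) m

/-- The service time of customer `m`. -/
noncomputable def markService (Y : ℕ → Ω → ℕ) (V : ℕ → Ω → E) (F : ℕ × E → ℕ) (ω : Ω) (m : ℕ) : ℕ :=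
  F (Y (markArrival Y ω m) ω, V m ω)

/-- The σ-algebras generated by the single marks and rows. -/
@[reducible] def inputAlgebra (Y : ℕ → Ω → ℕ) (V : ℕ → Ω → E) : ℕ ⊕ ℕ → MeasurableSpace Ω :=
  Sum.elim (fun j => MeasurableSpace.comap (Y j) inferInstance)
    (fun i => MeasurableSpace.comap (V i) inferInstance)

/-- The indices of the marks before slot `c` and of the rows of the customers before `m`. -/
def pastIndices (c m : ℕ) : Set (ℕ ⊕ ℕ) := Sum.inl '' Set.Iio c ∪ Sum.inr '' Set.Iio m

variable {P : Measure Ω} {Y : ℕ → Ω → ℕ} {V : ℕ → Ω → E} {F : ℕ × E → ℕ}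

theorem IsMarkedInput.inputAlgebra_le (h : IsMarkedInput P Y V) (i : ℕ ⊕ ℕ) :
    inputAlgebra Y V i ≤ ‹MeasurableSpace Ω› := by
  rcases i with j | i
  · exact (h.measurable_mark j).comap_le
  · exact (h.measurable_row i).comap_le

/-- Merges both sequences into one independent family over `ℕ ⊕ ℕ`, so that any two disjoint blocks
of marks and rows are independent. -/
theorem IsMarkedInput.iIndep (h : IsMarkedInput P Y V) : iIndep (inputAlgebra Y V) P := by
  rw [iIndep_iff]
  intro s f hf
  have hL := (iIndep_iff _ _).1 h.indep_mark.iIndep s.toLeft (f := fun j => f (Sum.inl j))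
    fun j hj => hf _ (Finset.mem_toLeft.1 hj)
  have hR := (iIndep_iff _ _).1 h.indep_row.iIndep s.toRight (f := fun i => f (Sum.inr i))
    fun i hi => hf _ (Finset.mem_toRight.1 hi)
  have hsplit : ⋂ i ∈ s, f i =
      (⋂ j ∈ s.toLeft, f (Sum.inl j)) ∩ ⋂ i ∈ s.toRight, f (Sum.inr i) := by
    ext ω
    simp only [Set.mem_iInter, Set.mem_inter_iff, Finset.mem_toLeft, Finset.mem_toRight,
      Sum.forall]
  have hcL : ∀ j, MeasurableSpace.comap (Y j) inferInstance ≤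
      MeasurableSpace.comap (fun ω j => Y j ω) inferInstance := fun j => by
    rintro _ ⟨t, ht, rfl⟩
    exact ⟨(fun y : ℕ → ℕ => y j) ⁻¹' t, measurable_pi_apply j ht, rfl⟩
  have hcR : ∀ i, MeasurableSpace.comap (V i) inferInstance ≤
      MeasurableSpace.comap (fun ω i => V i ω) inferInstance := fun i => by
    rintro _ ⟨t, ht, rfl⟩
    exact ⟨(fun y : ℕ → E => y i) ⁻¹' t, measurable_pi_apply i ht, rfl⟩
  rw [hsplit, (Indep_iff _ _ _).1 ((IndepFun_iff_Indep _ _ _).1 h.indep) _ _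
    (Finset.measurableSet_biInter _ fun j hj => hcL j _ (hf _ (Finset.mem_toLeft.1 hj)))
    (Finset.measurableSet_biInter _ fun i hi => hcR i _ (hf _ (Finset.mem_toRight.1 hi))),
    hL, hR]
  conv_rhs => rw [← s.toLeft_disjSum_toRight, Finset.prod_disjSum]

theorem IsMarkedInput.measure_inter (h : IsMarkedInput P Y V) {S T : Set (ℕ ⊕ ℕ)}
    (hST : Disjoint S T) {A B : Set Ω} (hA : MeasurableSet[⨆ i ∈ S, inputAlgebra Y V i] A)
    (hB : MeasurableSet[⨆ i ∈ T, inputAlgebra Y V i] B) : P (A ∩ B) = P A * P B :=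
  (Indep_iff _ _ _).1 (indep_iSup_of_disjoint h.inputAlgebra_le h.iIndep hST) A B hA hB

theorem measurable_mark_iSup {Ω : Type*} {Y : ℕ → Ω → ℕ} {V : ℕ → Ω → E} {S : Set (ℕ ⊕ ℕ)}
    {j : ℕ} (hj : Sum.inl j ∈ S) :
    Measurable[⨆ i ∈ S, inputAlgebra Y V i] (Y j) :=
  (comap_measurable (Y j)).mono (le_biSup (inputAlgebra Y V) hj) le_rfl

theorem measurable_row_iSup {Ω : Type*} {Y : ℕ → Ω → ℕ} {V : ℕ → Ω → E} {S : Set (ℕ ⊕ ℕ)}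
    {i : ℕ} (hi : Sum.inr i ∈ S) :
    Measurable[⨆ i ∈ S, inputAlgebra Y V i] (V i) :=
  (comap_measurable (V i)).mono (le_biSup (inputAlgebra Y V) hi) le_rfl

/-- After slot `c` there are `t` empty slots, followed by an arrival with service time `s`. -/
def nextArrivalEvent (Y : ℕ → Ω → ℕ) (V : ℕ → Ω → E) (F : ℕ × E → ℕ) (c m t s : ℕ) : Set Ω :=
  {ω | (∀ j < t, Y (c + j) ω = 0) ∧ 0 < Y (c + t) ω ∧ F (Y (c + t) ω, V m ω) = s}

theorem measurableSet_nextArrivalEvent {Ω : Type*} {Y : ℕ → Ω → ℕ} {V : ℕ → Ω → E}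
    (hF : Measurable F) (c m t s : ℕ) :
    MeasurableSet[⨆ i ∈ pastIndices (c + t + 1) (m + 1), inputAlgebra Y V i]
      (nextArrivalEvent Y V F c m t s) := by
  have hY : ∀ j ≤ t, Measurable[⨆ i ∈ pastIndices (c + t + 1) (m + 1), inputAlgebra Y V i]
      (Y (c + j)) := fun j hj => measurable_mark_iSup (Or.inl ⟨c + j, by simp; omega, rfl⟩)
  have hV : Measurable[⨆ i ∈ pastIndices (c + t + 1) (m + 1), inputAlgebra Y V i] (V m) :=
    measurable_row_iSup (Or.inr ⟨m, by simp, rfl⟩)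
  have h1 : nextArrivalEvent Y V F c m t s = (⋂ j ∈ Finset.range t, Y (c + j) ⁻¹' {0}) ∩
      (Y (c + t) ⁻¹' Set.Ioi 0 ∩ (fun ω => F (Y (c + t) ω, V m ω)) ⁻¹' {s}) := by
    ext ω; simp [nextArrivalEvent]
  rw [h1]
  refine MeasurableSet.inter (Finset.measurableSet_biInter _ fun j hj =>
    hY j (Finset.mem_range.1 hj).le (measurableSet_singleton 0)) (MeasurableSet.inter
      (hY t le_rfl measurableSet_Ioi) ?_)
  exact hF.comp ((hY t le_rfl).prodMk hV) (measurableSet_singleton s)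

theorem IsMarkedInput.map_prodMk [IsProbabilityMeasure P] (h : IsMarkedInput P Y V) (j i : ℕ) :
    P.map (fun ω => (Y j ω, V i ω)) = (P.map (Y 0)).prod (P.map (V 0)) := by
  have h1 : IndepFun (Y j) (V i) P :=
    h.indep.comp (measurable_pi_apply j) (measurable_pi_apply i)
  rw [(indepFun_iff_map_prod_eq_prod_map_map (h.measurable_mark j).aemeasurable
    (h.measurable_row i).aemeasurable).1 h1, h.map_mark, h.map_row]

/-- The renewal step: the past is independent of the next arrival. -/
theorem IsMarkedInput.measure_inter_nextArrivalEvent [IsProbabilityMeasure P]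
    (h : IsMarkedInput P Y V) (hF : Measurable F) (c m t s : ℕ) {H : Set Ω}
    (hH : MeasurableSet[⨆ i ∈ pastIndices c m, inputAlgebra Y V i] H) :
    P (H ∩ nextArrivalEvent Y V F c m t s) =
      P H * (P {ω | Y 0 ω = 0} ^ t * P {ω | 0 < Y 0 ω ∧ F (Y 0 ω, V 0 ω) = s}) := by
  have hmono : ∀ {S T : Set (ℕ ⊕ ℕ)}, S ⊆ T →
      ⨆ i ∈ S, inputAlgebra Y V i ≤ ⨆ i ∈ T, inputAlgebra Y V i := fun h => biSup_mono h
  -- `A t` is the past followed by `t` empty slots; each further slot is independent of it and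
  -- contributes one factor.
  set A : ℕ → Set Ω := fun t => H ∩ ⋂ j ∈ Finset.range t, Y (c + j) ⁻¹' {0} with hA
  have hAm : ∀ t, MeasurableSet[⨆ i ∈ pastIndices (c + t) m, inputAlgebra Y V i] (A t) :=
      fun t => by
    refine MeasurableSet.inter (hmono ?_ _ hH) (Finset.measurableSet_biInter _ fun j hj =>
      measurable_mark_iSup (Or.inl ⟨c + j, ?_, rfl⟩) (measurableSet_singleton 0))
    · rintro _ (⟨j, hj, rfl⟩ | ⟨i, hi, rfl⟩)
      · exact Or.inl ⟨j, lt_of_lt_of_le hj (Nat.le_add_right _ _), rfl⟩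
      · exact Or.inr ⟨i, hi, rfl⟩
    · simpa using hj
  have hAP : ∀ t, P (A t) = P H * P {ω | Y 0 ω = 0} ^ t := fun t => by
    induction t with
    | zero => simp [hA]
    | succ t ih =>
      have h1 : A (t + 1) = A t ∩ Y (c + t) ⁻¹' {0} := by
        simp only [hA]
        ext ω
        simp only [Set.mem_inter_iff, Set.mem_iInter, Finset.mem_range, Nat.lt_succ_iff_lt_or_eq]
        constructor
        · rintro ⟨h1, h2⟩
          exact ⟨⟨h1, fun j hj => h2 j (Or.inl hj)⟩, h2 t (Or.inr rfl)⟩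
        · rintro ⟨⟨h1, h2⟩, h3⟩
          exact ⟨h1, fun j hj => hj.elim (h2 j) fun e => e ▸ h3⟩
      rw [h1, h.measure_inter (T := {Sum.inl (c + t)}) ?_ (hAm t)
        (measurable_mark_iSup (Set.mem_singleton _) (measurableSet_singleton 0)), ih,
        ← Measure.map_apply (h.measurable_mark _) (measurableSet_singleton 0), h.map_mark,
        Measure.map_apply (h.measurable_mark _) (measurableSet_singleton 0), pow_succ, mul_assoc]
      · rfl
      · simp [pastIndices]
  have h2 : H ∩ nextArrivalEvent Y V F c m t s =
      A t ∩ {ω | 0 < Y (c + t) ω ∧ F (Y (c + t) ω, V m ω) = s} := by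
    ext ω
    simp [hA, nextArrivalEvent, and_assoc]
  set C : Set (ℕ × E) := {y | 0 < y.1 ∧ F y = s} with hC
  have hCm : MeasurableSet C :=
    (measurable_fst measurableSet_Ioi).inter (hF (measurableSet_singleton s))
  have h3 : ∀ j i, {ω | 0 < Y j ω ∧ F (Y j ω, V i ω) = s} = (fun ω => (Y j ω, V i ω)) ⁻¹' C :=
    fun j i => rfl
  rw [h2, h.measure_inter (T := {Sum.inl (c + t), Sum.inr m}) ?_ (hAm t), hAP, mul_assoc, h3, h3,
    ← Measure.map_apply ((h.measurable_mark _).prodMk (h.measurable_row _)) hCm,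
    ← Measure.map_apply ((h.measurable_mark _).prodMk (h.measurable_row _)) hCm,
    h.map_prodMk, h.map_prodMk]
  · rw [h3]
    exact (Measurable.prodMk (measurable_mark_iSup (by simp)) (measurable_row_iSup (by simp))) hCm
  · simp [pastIndices]

end Marks

/-! ### Laws of delay and peak age along the queue -/

section QueueLaw

/-- The delay of the previous customer: `0` before the first customer, else `delay α S (m - 1)`. -/
def prevDelay (α S : ℕ → ℕ) : ℕ → ℕ
  | 0 => 0
  | m + 1 => delay α S m

/-- Lindley's recursion. With `slotsUsed` and `prevDelay` starting at `0`, the first customer obeys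
the same rule as the others. -/
theorem prevDelay_succ {p : ℕ → Prop} (hp : (Set.ofPred p).Infinite) (S : ℕ → ℕ) (m : ℕ) :
    prevDelay (Nat.nth p) S (m + 1) =
      prevDelay (Nat.nth p) S m - (slotsUsed p (m + 1) - slotsUsed p m) + S m := by
  cases m with
  | zero => simp [prevDelay, delay, waiting]
  | succ m =>
    have h1 := Nat.nth_strictMono hp (Nat.lt_succ_self m)
    have h2 := departure_eq (Nat.nth p) S m
    simp only [prevDelay, slotsUsed]
    conv_lhs => rw [delay, waiting, h2]
    simp only [Nat.succ_eq_add_one] at h1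
    omega

variable {Ω E : Type*} [MeasurableSpace Ω] [MeasurableSpace E]
  {P : Measure Ω} {Y : ℕ → Ω → ℕ} {V : ℕ → Ω → E} {F : ℕ × E → ℕ}

theorem measure_eq_tsum_fiber {f : Ω → ℕ} (hf : Measurable f) {A : Set Ω} (hA : MeasurableSet A) :
    P A = ∑' c, P (A ∩ {ω | f ω = c}) := by
  rw [← measure_iUnion]
  · congr 1
    ext ω
    simp
  · intro c c' hcc
    refine Set.disjoint_left.2 fun ω h h' => hcc ?_
    exact h.2.symm.trans h'.2
  · exact fun c => hA.inter (hf (measurableSet_singleton c))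

namespace IsMarkedInput

theorem measurable_markArrival (h : IsMarkedInput P Y V)
    (m : ℕ) : Measurable fun ω => markArrival Y ω m :=
  measurable_nth (p := fun ω t => 0 < Y t ω) (fun j => h.measurable_mark j measurableSet_Ioi) m

theorem measurable_slotsUsed (h : IsMarkedInput P Y V)
    (m : ℕ) : Measurable fun ω => slotsUsed (fun t => 0 < Y t ω) m := by
  cases m with
  | zero => exact measurable_const
  | succ m => exact (h.measurable_markArrival m).add measurable_const

theorem measurable_markService (h : IsMarkedInput P Y V) (hF : Measurable F) (m : ℕ) :
    Measurable fun ω => markService Y V F ω m := by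
  refine hF.comp (Measurable.prodMk ?_ (h.measurable_row m))
  have h1 : Measurable fun x : ℕ × Ω => Y x.1 x.2 :=
    measurable_from_prod_countable_right fun j => h.measurable_mark j
  exact h1.comp ((h.measurable_markArrival m).prodMk measurable_id)

theorem measurable_departure (h : IsMarkedInput P Y V) (hF : Measurable F) (m : ℕ) :
    Measurable fun ω => departure (markArrival Y ω) (markService Y V F ω) m := by
  induction m with
  | zero => exact (h.measurable_markArrival 0).add (h.measurable_markService hF 0)
  | succ m ih =>
    exact (ih.max (h.measurable_markArrival _)).add (h.measurable_markService hF _)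

theorem measurable_prevDelay (h : IsMarkedInput P Y V) (hF : Measurable F) (m : ℕ) :
    Measurable fun ω => prevDelay (markArrival Y ω) (markService Y V F ω) m := by
  cases m with
  | zero => exact measurable_const
  | succ m =>
    have h1 : (fun ω => prevDelay (markArrival Y ω) (markService Y V F ω) (m + 1)) = fun ω =>
        departure (markArrival Y ω) (markService Y V F ω) m - markArrival Y ω m := by
      funext ω
      rw [departure_eq, Nat.add_sub_cancel_left, prevDelay]
    rw [h1]
    exact (h.measurable_departure hF m).sub (h.measurable_markArrival m)

/-- The probability of no arrival from slot `c` on is at most that of `t` empty slots, for every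
`t`. -/
theorem ae_infinite (h : IsMarkedInput P Y V) (hp : P {ω | Y 0 ω = 0} < 1) :
    ∀ᵐ ω ∂P, (Set.ofPred fun t => 0 < Y t ω).Infinite := by
  have h0 : ∀ c, P {ω | ∀ j, Y (c + j) ω = 0} = 0 := fun c => by
    have h1 : ∀ t, P {ω | ∀ j, Y (c + j) ω = 0} ≤ P {ω | Y 0 ω = 0} ^ t := fun t => by
      calc P {ω | ∀ j, Y (c + j) ω = 0}
          ≤ P (⋂ j ∈ Finset.range t, Y (c + j) ⁻¹' {0}) :=
            measure_mono fun ω hω => by simpa using fun j _ => hω j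
        _ = ∏ j ∈ Finset.range t, P (Y (c + j) ⁻¹' {0}) :=
            (h.indep_mark.precomp (add_right_injective c)).meas_biInter fun j _ =>
              ⟨{0}, measurableSet_singleton 0, rfl⟩
        _ = P {ω | Y 0 ω = 0} ^ t := by
            rw [Finset.prod_congr rfl fun j _ => ?_, Finset.prod_const, Finset.card_range]
            rw [← Measure.map_apply (h.measurable_mark _) (measurableSet_singleton 0), h.map_mark,
              Measure.map_apply (h.measurable_mark _) (measurableSet_singleton 0)]
            rfl
    exact le_antisymm (ge_of_tendsto' (ENNReal.tendsto_pow_atTop_nhds_zero_of_lt_one hp) h1) bot_le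
  have h1 : ∀ᵐ ω ∂P, ∀ c, ¬∀ j, Y (c + j) ω = 0 :=
    ae_all_iff.2 fun c => by rw [ae_iff]; simpa using h0 c
  filter_upwards [h1] with ω hω
  refine Set.infinite_of_forall_exists_gt fun c => ?_
  obtain ⟨j, hj⟩ := not_forall.1 (hω (c + 1))
  exact ⟨c + 1 + j, Nat.pos_of_ne_zero hj, by omega⟩

/-- Up to a null set, the delay and the last arrival slot depend only on the past. -/
theorem exists_past_event (h : IsMarkedInput P Y V)
    (hF : Measurable F) (hp : P {ω | Y 0 ω = 0} < 1) (m c d : ℕ) :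
    ∃ H, MeasurableSet[⨆ i ∈ pastIndices c m, inputAlgebra Y V i] H ∧
      ∀ᵐ ω ∂P, (prevDelay (markArrival Y ω) (markService Y V F ω) m = d ∧
        slotsUsed (fun t => 0 < Y t ω) m = c) ↔ ω ∈ H := by
  induction m generalizing c d with
  | zero =>
    by_cases hcd : 0 = d ∧ 0 = c
    · exact ⟨Set.univ, @MeasurableSet.univ _ (_), Eventually.of_forall fun ω =>
        ⟨fun _ => Set.mem_univ _, fun _ => hcd⟩⟩
    · exact ⟨∅, @MeasurableSet.empty _ (_), Eventually.of_forall fun ω =>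
        ⟨fun hω => hcd hω, fun hω => hω.elim⟩⟩
  | succ m ih =>
    choose H hHm hH using ih
    -- All ways to reach `(c, d)`: from slot count `c'` and delay `d'`, through `t` empty slots and
    -- an arrival with service `s`. The gap is `t + 1`, since it includes the arrival slot.
    refine ⟨⋃ (c' : ℕ) (d' : ℕ) (t : ℕ) (s : ℕ) (_ : c' + t + 1 = c) (_ : d' - (t + 1) + s = d),
      H c' d' ∩ nextArrivalEvent Y V F c' m t s, ?_, ?_⟩
    · refine MeasurableSet.iUnion fun c' => MeasurableSet.iUnion fun d' => MeasurableSet.iUnion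
        fun t => MeasurableSet.iUnion fun s => MeasurableSet.iUnion fun hc => MeasurableSet.iUnion
        fun _ => MeasurableSet.inter ?_ (hc ▸ measurableSet_nextArrivalEvent hF c' m t s)
      refine biSup_mono (f := inputAlgebra Y V) ?_ _ (hHm c' d')
      rintro _ (⟨j, hj, rfl⟩ | ⟨i, hi, rfl⟩)
      · exact Or.inl ⟨j, by simp at hj ⊢; omega, rfl⟩
      · exact Or.inr ⟨i, by simp at hi ⊢; omega, rfl⟩
    · have hall : ∀ᵐ ω ∂P, ∀ c' d', (prevDelay (markArrival Y ω) (markService Y V F ω) m = d' ∧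
          slotsUsed (fun t => 0 < Y t ω) m = c') ↔ ω ∈ H c' d' :=
        ae_all_iff.2 fun c' => ae_all_iff.2 fun d' => hH c' d'
      filter_upwards [h.ae_infinite hp, hall] with ω hinf hω
      have hD := prevDelay_succ hinf (markService Y V F ω) m
      have hle := slotsUsed_le_nth hinf m
      have hsucc : slotsUsed (fun t => 0 < Y t ω) (m + 1) = markArrival Y ω m + 1 := rfl
      simp only [Set.mem_iUnion]
      refine ⟨?_, ?_⟩
      · rintro ⟨hd, hc⟩
        obtain ⟨t, ht⟩ := Nat.exists_eq_add_of_le hle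
        have h1 := (nth_eq_slotsUsed_add_iff hinf m t).1 ht
        refine ⟨_, _, t, markService Y V F ω m, ?_, ?_, (hω _ _).1 ⟨rfl, rfl⟩, ?_⟩
        · change markArrival Y ω m = _ at ht
          omega
        · change markArrival Y ω m = _ at ht
          rw [← hd]
          change _ = prevDelay (Nat.nth _) _ _
          rw [hD, hsucc, ht, add_assoc, Nat.add_sub_cancel_left]
          rfl
        · refine ⟨fun j hj => by simpa using h1.1 j hj, h1.2, ?_⟩
          rw [← ht]
          rfl
      · rintro ⟨c', d', t, s, hc, hd, hH', hJ⟩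
        obtain ⟨h1, h2⟩ := (hω c' d').2 hH'
        have ht : markArrival Y ω m = c' + t := by
          have := (nth_eq_slotsUsed_add_iff hinf m t).2
            ⟨fun j hj => by rw [h2, hJ.1 j hj]; simp, by rw [h2]; exact hJ.2.1⟩
          rw [h2] at this
          exact this
        have hs : markService Y V F ω m = s := by
          rw [markService, ht]
          exact hJ.2.2
        refine ⟨?_, ?_⟩
        · change prevDelay (Nat.nth _) _ _ = _
          rw [hD, hsucc, ht, h2, hs]
          change prevDelay (Nat.nth _) _ _ = _ at h1
          rw [h1, add_assoc, Nat.add_sub_cancel_left]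
          exact hd
        · rw [hsucc, ht, hc]

variable [IsProbabilityMeasure P]

/-- The random arrival time is resolved by summing over the values `c` of `slotsUsed`. For fixed `c`
the renewal step applies to a past event, and its second factor does not depend on `c`. -/
theorem measure_prevDelay_gap_service (h : IsMarkedInput P Y V)
    (hF : Measurable F) (hp : P {ω | Y 0 ω = 0} < 1)
    (m d t s : ℕ) :
    P {ω | prevDelay (markArrival Y ω) (markService Y V F ω) m = d ∧
        slotsUsed (fun t => 0 < Y t ω) (m + 1) - slotsUsed (fun t => 0 < Y t ω) m = t + 1 ∧
        markService Y V F ω m = s} =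
      P {ω | prevDelay (markArrival Y ω) (markService Y V F ω) m = d} *
        (P {ω | Y 0 ω = 0} ^ t * P {ω | 0 < Y 0 ω ∧ F (Y 0 ω, V 0 ω) = s}) := by
  have hD : MeasurableSet {ω | prevDelay (markArrival Y ω) (markService Y V F ω) m = d} :=
    h.measurable_prevDelay hF m (measurableSet_singleton d)
  have hS : MeasurableSet {ω | markService Y V F ω m = s} :=
    h.measurable_markService hF m (measurableSet_singleton s)
  have hT : MeasurableSet {ω | slotsUsed (fun t => 0 < Y t ω) (m + 1) -
      slotsUsed (fun t => 0 < Y t ω) m = t + 1} :=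
    ((h.measurable_slotsUsed (m + 1)).sub (h.measurable_slotsUsed m))
      (measurableSet_singleton (t + 1))
  rw [Set.ofPred_and, Set.ofPred_and,
    measure_eq_tsum_fiber (h.measurable_slotsUsed m) (hD.inter (hT.inter hS)),
    measure_eq_tsum_fiber (h.measurable_slotsUsed m) hD, ← ENNReal.tsum_mul_right]
  refine tsum_congr fun c => ?_
  obtain ⟨H, hHm, hH⟩ := h.exists_past_event hF hp m c d
  have hH2 : ({ω | prevDelay (markArrival Y ω) (markService Y V F ω) m = d} ∩
      {ω | slotsUsed (fun t => 0 < Y t ω) m = c} : Set Ω) =ᵐ[P] H := eventuallyEq_set.2 hH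
  rw [measure_congr hH2, ← h.measure_inter_nextArrivalEvent hF c m t s hHm]
  refine measure_congr (eventuallyEq_set.2 ?_)
  filter_upwards [h.ae_infinite hp, hH] with ω hinf hω'
  have hle := slotsUsed_le_nth hinf m
  have hsucc : slotsUsed (fun t => 0 < Y t ω) (m + 1) = markArrival Y ω m + 1 := rfl
  have hnth := nth_eq_slotsUsed_add_iff hinf m t
  change slotsUsed _ m ≤ markArrival Y ω m at hle
  change markArrival Y ω m = _ ↔ _ at hnth
  refine ⟨?_, ?_⟩
  · rintro ⟨⟨hd, hgap, hs⟩, hc⟩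
    simp only [Set.mem_ofPred_eq] at hc
    have ht : markArrival Y ω m = slotsUsed (fun t => 0 < Y t ω) m + t := by
      change slotsUsed _ (m + 1) - slotsUsed _ m = t + 1 at hgap
      omega
    have h1 := hnth.1 ht
    rw [hc] at h1 ht
    refine ⟨hω'.1 ⟨hd, hc⟩, fun j hj => by simpa using h1.1 j hj, h1.2, ?_⟩
    rw [← ht]
    exact hs
  · rintro ⟨hH', hJ⟩
    obtain ⟨hd, hc⟩ := hω'.2 hH'
    have ht := hnth.2 ⟨fun j hj => by rw [hc, hJ.1 j hj]; simp, by rw [hc]; exact hJ.2.1⟩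
    refine ⟨⟨hd, ?_, ?_⟩, hc⟩
    · change slotsUsed _ (m + 1) - slotsUsed _ m = t + 1
      omega
    · change F _ = s
      rw [ht, hc]
      exact hJ.2.2

end IsMarkedInput

/-- The number of slots from the previous arrival (or from the start) to that of customer `m`. -/
noncomputable def markGap (Y : ℕ → Ω → ℕ) (m : ℕ) (ω : Ω) : ℕ :=
  slotsUsed (fun t => 0 < Y t ω) (m + 1) - slotsUsed (fun t => 0 < Y t ω) m

namespace IsMarkedInput

theorem measurable_markGap (h : IsMarkedInput P Y V) (m : ℕ) : Measurable (markGap Y m) :=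
  (h.measurable_slotsUsed (m + 1)).sub (h.measurable_slotsUsed m)

theorem ae_markGap_pos (h : IsMarkedInput P Y V)
    (hp : P {ω | Y 0 ω = 0} < 1) (m : ℕ) : ∀ᵐ ω ∂P, 0 < markGap Y m ω := by
  filter_upwards [h.ae_infinite hp] with ω hω
  have h1 := slotsUsed_le_nth hω m
  have h2 : slotsUsed (fun t => 0 < Y t ω) (m + 1) = Nat.nth (fun t => 0 < Y t ω) m + 1 := rfl
  rw [markGap]
  omega

variable [IsProbabilityMeasure P]

theorem measure_gap_service_zero (h : IsMarkedInput P Y V)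
    (hF : Measurable F) (hp : P {ω | Y 0 ω = 0} < 1) (t s : ℕ) :
    P ({ω | markService Y V F ω 0 = s} ∩ {ω | markGap Y 0 ω = t + 1}) =
      P {ω | Y 0 ω = 0} ^ t * P {ω | 0 < Y 0 ω ∧ F (Y 0 ω, V 0 ω) = s} := by
  have h1 := h.measure_prevDelay_gap_service hF hp 0 0 t s
  simp only [prevDelay, true_and] at h1
  rw [show {_ω : Ω | True} = Set.univ from Set.eq_univ_of_forall fun _ => trivial, measure_univ,
    one_mul] at h1
  rw [← h1, Set.inter_comm]
  rfl

theorem measure_mark_pos (h : IsMarkedInput P Y V) : P {ω | 0 < Y 0 ω} = 1 - P {ω | Y 0 ω = 0} := by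
  have h1 : MeasurableSet {ω | Y 0 ω = 0} := h.measurable_mark 0 (measurableSet_singleton 0)
  rw [← prob_compl_eq_one_sub h1]
  congr 1
  ext ω
  exact Nat.pos_iff_ne_zero

theorem measureReal_mark_zero (h : IsMarkedInput P Y V)
    : P.real {ω | Y 0 ω = 0} = 1 - P.real {ω | 0 < Y 0 ω} := by
  rw [measureReal_def P {ω | 0 < Y 0 ω}, h.measure_mark_pos,
    ENNReal.toReal_sub_of_le prob_le_one (by simp), measureReal_def]
  simp

theorem measure_mark_zero_lt_one (h : IsMarkedInput P Y V)
    (hp : 0 < P.real {ω | 0 < Y 0 ω}) : P {ω | Y 0 ω = 0} < 1 := by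
  have h1 := h.measureReal_mark_zero
  rw [← ENNReal.toReal_lt_toReal (by finiteness) (by simp), ENNReal.toReal_one]
  change P.real _ < 1
  linarith

/-- Summing over the gap cancels the geometric series: the service law is that of `F` conditioned on
a positive mark. -/
theorem measure_service_zero (h : IsMarkedInput P Y V)
    (hF : Measurable F) (hp : P {ω | Y 0 ω = 0} < 1) (s : ℕ) :
    P {ω | 0 < Y 0 ω} * P {ω | markService Y V F ω 0 = s} =
      P {ω | 0 < Y 0 ω ∧ F (Y 0 ω, V 0 ω) = s} := by
  have hS : MeasurableSet {ω | markService Y V F ω 0 = s} :=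
    h.measurable_markService hF 0 (measurableSet_singleton s)
  have h1 := measure_eq_tsum_fiber (P := P) (h.measurable_markGap 0) hS
  rw [tsum_eq_zero_add' ENNReal.summable] at h1
  have h2 : P ({ω | markService Y V F ω 0 = s} ∩ {ω | markGap Y 0 ω = 0}) = 0 := by
    refine measure_mono_null Set.inter_subset_right ?_
    have := h.ae_markGap_pos hp 0
    rw [ae_iff] at this
    simpa using this
  simp_rw [h2, h.measure_gap_service_zero hF hp, ENNReal.tsum_mul_right, ENNReal.tsum_geometric,
    zero_add] at h1
  rw [h1, h.measure_mark_pos, ← mul_assoc, ENNReal.mul_inv_cancel (tsub_pos_of_lt hp).ne'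
    (by finiteness),
    one_mul]

theorem measure_gap_zero (h : IsMarkedInput P Y V) (hp : P {ω | Y 0 ω = 0} < 1) (t : ℕ) :
    P {ω | markGap Y 0 ω = t + 1} = P {ω | 0 < Y 0 ω} * P {ω | Y 0 ω = 0} ^ t := by
  -- With a service that is constantly `0`, the joint law collapses to that of the gap.
  have h1 := h.measure_gap_service_zero (F := fun _ => 0) measurable_const hp t 0
  simp only [markService, and_true] at h1
  rw [show {_ω : Ω | True} = Set.univ from Set.eq_univ_of_forall fun _ => trivial,
    Set.univ_inter] at h1
  rw [h1, mul_comm]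

variable {p : ℝ}

theorem isGeometric_gap (h : IsMarkedInput P Y V)
    (hp0 : 0 < p) (hp1 : p < 1) (hp : P.real {ω | 0 < Y 0 ω} = p) :
    IsGeometric p (P.map (markGap Y 0)) where
  isProbabilityMeasure := Measure.isProbabilityMeasure_map (h.measurable_markGap 0).aemeasurable
  pos := hp0
  lt_one := hp1
  apply_succ k := by
    have h1 := h.measure_gap_zero (h.measure_mark_zero_lt_one (hp ▸ hp0)) k
    rw [measureReal_def, Measure.map_apply (h.measurable_markGap 0) (measurableSet_singleton _)]
    change (P {ω | markGap Y 0 ω = k + 1}).toReal = _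
    rw [h1, ENNReal.toReal_mul, ENNReal.toReal_pow]
    change P.real _ * P.real _ ^ k = _
    rw [h.measureReal_mark_zero, hp]

/-- The delay, the next gap and the next service time are independent. -/
theorem map_prevDelay_gap_service (h : IsMarkedInput P Y V)
    (hF : Measurable F) (hp : 0 < P.real {ω | 0 < Y 0 ω}) (m : ℕ) :
    P.map (fun ω => (prevDelay (markArrival Y ω) (markService Y V F ω) m, markGap Y m ω,
      markService Y V F ω m)) =
      (P.map fun ω => prevDelay (markArrival Y ω) (markService Y V F ω) m).prod
        ((P.map (markGap Y 0)).prod (P.map fun ω => markService Y V F ω 0)) := by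
  have hp' := h.measure_mark_zero_lt_one hp
  have hD := h.measurable_prevDelay hF m
  have hT := h.measurable_markGap
  have hS := h.measurable_markService hF
  have := Measure.isProbabilityMeasure_map (μ := P) (hT 0).aemeasurable
  have := Measure.isProbabilityMeasure_map (μ := P) (hS 0).aemeasurable
  have hgap0 : ∀ m, P {ω | markGap Y m ω = 0} = 0 := fun m => by
    have := h.ae_markGap_pos hp' m
    rw [ae_iff] at this
    simpa using this
  refine Measure.ext_of_singleton fun ⟨d, t, s⟩ => ?_
  rw [← Set.singleton_prod_singleton, ← Set.singleton_prod_singleton, Measure.prod_prod,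
    Measure.prod_prod, Measure.map_apply (hD.prodMk ((hT m).prodMk (hS m)))
      ((measurableSet_singleton _).prod ((measurableSet_singleton _).prod
        (measurableSet_singleton _))),
    Measure.map_apply hD (measurableSet_singleton _),
    Measure.map_apply (hT 0) (measurableSet_singleton _),
    Measure.map_apply (hS 0) (measurableSet_singleton _)]
  match t with
  | 0 =>
    have h1 : P (markGap Y 0 ⁻¹' {0}) = 0 := hgap0 0
    rw [h1, zero_mul, mul_zero]
    exact measure_mono_null (fun ω hω => hω.2.1) (hgap0 m)
  | t + 1 =>
    have h1 := h.measure_prevDelay_gap_service hF hp' m d t s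
    have h2 := h.measure_gap_zero hp' t
    rw [← h.measure_service_zero hF hp' s] at h1
    change P {ω | _ ∧ _ ∧ _} = P {ω | _} * (P {ω | markGap Y 0 ω = t + 1} * P {ω | _})
    rw [h2, mul_comm (P {ω | 0 < Y 0 ω}), mul_assoc]
    exact h1

theorem map_prevDelay (h : IsMarkedInput P Y V)
    (hF : Measurable F) (hp : 0 < P.real {ω | 0 < Y 0 ω}) (m : ℕ) :
    P.map (fun ω => prevDelay (markArrival Y ω) (markService Y V F ω) m) =
      lindleyLaw (P.map (markGap Y 0)) (P.map fun ω => markService Y V F ω 0) m := by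
  induction m with
  | zero => simp [prevDelay, lindleyLaw]
  | succ m ih =>
    have hD := h.measurable_prevDelay hF m
    have hT := h.measurable_markGap m
    have hS := h.measurable_markService hF m
    rw [lindleyLaw, lindleyStep, ← ih, ← h.map_prevDelay_gap_service hF hp,
      Measure.map_map (by fun_prop) (hD.prodMk (hT.prodMk hS))]
    refine Measure.map_congr ?_
    filter_upwards [h.ae_infinite (h.measure_mark_zero_lt_one hp)] with ω hω
    exact prevDelay_succ hω _ m

theorem map_peakAge (h : IsMarkedInput P Y V)
    (hF : Measurable F) (hp : 0 < P.real {ω | 0 < Y 0 ω}) (m : ℕ) :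
    P.map (fun ω => peakAge (markArrival Y ω) (markService Y V F ω) m) =
      peakLaw (P.map (markGap Y 0)) (P.map fun ω => markService Y V F ω 0)
        (lindleyLaw (P.map (markGap Y 0)) (P.map fun ω => markService Y V F ω 0) (m + 1)) := by
  have hD := h.measurable_prevDelay hF (m + 1)
  have hT := h.measurable_markGap (m + 1)
  have hS := h.measurable_markService hF (m + 1)
  rw [peakLaw, ← h.map_prevDelay hF hp, ← h.map_prevDelay_gap_service hF hp,
    Measure.map_map (by fun_prop) (hD.prodMk (hT.prodMk hS))]
  congr 1
  funext ω
  simp only [peakAge, Function.comp, prevDelay, markGap, slotsUsed, Nat.add_sub_add_right]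
  rfl

/-- The first customer never waits, so its service time is `prevDelay` at `1`; the independence
asked for is then a marginal of the triple law at `m = 1`. -/
theorem map_gap_service (h : IsMarkedInput P Y V)
    (hF : Measurable F) (hp : 0 < P.real {ω | 0 < Y 0 ω}) :
    P.map (fun ω => (markArrival Y ω 1 - markArrival Y ω 0, markService Y V F ω 0)) =
      (P.map (markGap Y 0)).prod (P.map fun ω => markService Y V F ω 0) := by
  have hD := h.measurable_prevDelay hF 1
  have hT := h.measurable_markGap 1
  have hS := h.measurable_markService hF
  have := Measure.isProbabilityMeasure_map (μ := P) (h.measurable_markGap 0).aemeasurable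
  have := Measure.isProbabilityMeasure_map (μ := P) (hS 0).aemeasurable
  have h1 := h.map_prevDelay_gap_service hF hp 1
  have h2 : ∀ ω, prevDelay (markArrival Y ω) (markService Y V F ω) 1 = markService Y V F ω 0 :=
    fun ω => by simp [prevDelay, delay, waiting]
  simp only [h2] at h1
  have h3 := congrArg (Measure.map fun x : ℕ × ℕ × ℕ => (x.2.1, x.1)) h1
  rw [Measure.map_map (by fun_prop) ((hS 0).prodMk (hT.prodMk (hS 1)))] at h3
  have h4 : (fun x : ℕ × ℕ × ℕ => (x.2.1, x.1)) = Prod.swap ∘ Prod.map id Prod.fst := rfl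
  rw [h4, ← Measure.map_map (μ := Measure.prod _ _) (by fun_prop) (by fun_prop),
    ← Measure.map_prod_map _ _ measurable_id measurable_fst, Measure.map_id,
    Measure.map_fst_prod, measure_univ, one_smul, Measure.prod_swap] at h3
  rw [← h3]
  congr 1
  funext ω
  simp only [Function.comp, Prod.map, Prod.swap, id, markGap, slotsUsed, Nat.add_sub_add_right]
  rfl

/-- Delay and peak age of a stable queue converge to a steady state. -/
theorem exists_isSteadyState (h : IsMarkedInput P Y V)
    (hF : Measurable F) {M : ℝ} (hp0 : 0 < p) (hp1 : p < 1)
    (hp : P.real {ω | 0 < Y 0 ω} = p)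
    (hM : Tendsto (fun s : ℝ => (1 - ∫ k : ℕ, s ^ k ∂(P.map fun ω => markService Y V F ω 0)) /
      (1 - s)) (𝓝[<] 1) (𝓝 M)) (hpM : p * M < 1) :
    ∃ πD πA : Measure ℕ,
      IsSteadyState P (fun m ω => delay (markArrival Y ω) (markService Y V F ω) m) πD ∧
      IsSteadyState P (fun m ω => peakAge (markArrival Y ω) (markService Y V F ω) m) πA ∧
      πA = (πD.prod P).map (fun x : ℕ × Ω =>
        max x.1 (markArrival Y x.2 1 - markArrival Y x.2 0) + markService Y V F x.2 0) ∧
      lindleyStep (P.map (markGap Y 0)) (P.map fun ω => markService Y V F ω 0) πD = πD ∧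
      ∫ k : ℕ, (1 - p) ^ k ∂πD = 1 - p * M ∧
      πA = peakLaw (P.map (markGap Y 0)) (P.map fun ω => markService Y V F ω 0) πD := by
  have hpos : 0 < P.real {ω | 0 < Y 0 ω} := hp ▸ hp0
  have hγ := h.isGeometric_gap hp0 hp1 hp
  have hS := h.measurable_markService hF
  have hα := h.measurable_markArrival
  have := hγ.isProbabilityMeasure
  have := Measure.isProbabilityMeasure_map (μ := P) (hS 0).aemeasurable
  obtain ⟨π, hπ, hconv, hstat, hnorm⟩ := exists_stationary hγ hM hpM
  refine ⟨π, _, ⟨hπ, fun k => ?_⟩, ⟨inferInstance, fun k => ?_⟩, ?_, hstat, hnorm, rfl⟩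
  · refine ((hconv k).comp (tendsto_add_atTop_nat 1)).congr fun m => ?_
    rw [Function.comp, ← h.map_prevDelay hF hpos,
      Measure.map_apply (h.measurable_prevDelay hF _) (by measurability)]
    rfl
  · refine ((tendsto_peakLaw hconv k).comp (tendsto_add_atTop_nat 1)).congr fun m => ?_
    have hm : Measurable fun ω => peakAge (markArrival Y ω) (markService Y V F ω) m :=
      ((h.measurable_prevDelay hF (m + 1)).max ((hα _).sub (hα _))).add (hS _)
    rw [Function.comp, ← h.map_peakAge hF hpos, Measure.map_apply hm (by measurability)]
    rfl
  · have hαS : Measurable fun ω =>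
        (markArrival Y ω 1 - markArrival Y ω 0, markService Y V F ω 0) :=
      ((hα 1).sub (hα 0)).prodMk (hS 0)
    rw [peakLaw, ← h.map_gap_service hF hpos]
    conv_lhs => rw [← Measure.map_id (μ := π)]
    rw [Measure.map_prod_map _ _ measurable_id hαS, Measure.map_map (by fun_prop) (by fun_prop)]
    rfl

end IsMarkedInput

end QueueLaw

/-! ### Rows of doubly indexed independent families -/

section Rows

variable {Ω ι κ B : Type*} [MeasurableSpace Ω] [MeasurableSpace B] {P : Measure Ω}
  {U : ι × κ → Ω → B}

/-- The rows of an independent doubly indexed family are independent. -/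
theorem iIndepFun_rows [IsProbabilityMeasure P] (hU : iIndepFun U P) (hm : ∀ i, Measurable (U i)) :
    iIndepFun (fun i ω k => U (i, k) ω) P := by
  have hprob : ∀ i k, IsProbabilityMeasure (P.map (U (i, k))) := fun i k =>
    Measure.isProbabilityMeasure_map (hm _).aemeasurable
  have hrow : ∀ i, P.map (fun ω k => U (i, k) ω) = Measure.infinitePi fun k => P.map (U (i, k)) :=
    fun i => (hU.precomp (Prod.mk_right_injective i)).map_fun_eq_infinitePi_map fun k => hm _
  rw [iIndepFun_iff_map_fun_eq_infinitePi_map (by fun_prop)]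
  simp_rw [hrow]
  rw [← Measure.infinitePi_map_curry (fun i k => P.map (U (i, k))),
    ← hU.map_fun_eq_infinitePi_map hm, Measure.map_map (by fun_prop) (by fun_prop)]
  rfl

theorem map_row_eq [IsProbabilityMeasure P] (hU : iIndepFun U P) (hm : ∀ i, Measurable (U i))
    {ν : Measure B} (hν : ∀ i, P.map (U i) = ν) (i : ι) :
    P.map (fun ω k => U (i, k) ω) = Measure.infinitePi fun _ => ν := by
  rw [(hU.precomp (Prod.mk_right_injective i)).map_fun_eq_infinitePi_map fun k => hm _]
  exact congrArg Measure.infinitePi (funext fun k => hν (i, k))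

end Rows

/-! ### Law and generating function of the service time -/

section ServiceLaw

variable {Ω E : Type*} [MeasurableSpace Ω] [MeasurableSpace E] {P : Measure Ω}
  [IsProbabilityMeasure P] {Y : ℕ → Ω → ℕ} {V : ℕ → Ω → E} {F : ℕ × E → ℕ}

/-- The service law is the law of the service of a row, given that its mark is positive. -/
theorem IsMarkedInput.smul_map_service (h : IsMarkedInput P Y V) (hF : Measurable F)
    (hp : 0 < P.real {ω | 0 < Y 0 ω}) :
    P {ω | 0 < Y 0 ω} • P.map (fun ω => markService Y V F ω 0) =
      (((P.map (Y 0)).restrict (Set.Ioi 0)).prod (P.map (V 0))).map F := by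
  have hY := h.measurable_mark 0
  have hV := h.measurable_row 0
  refine Measure.ext_of_singleton fun s => ?_
  rw [Measure.smul_apply, Measure.map_apply (h.measurable_markService hF 0)
    (measurableSet_singleton s), smul_eq_mul]
  refine (h.measure_service_zero hF (h.measure_mark_zero_lt_one hp) s).trans ?_
  conv_rhs => rw [← Measure.restrict_univ (μ := P.map (V 0))]
  rw [Measure.prod_restrict, ← h.map_prodMk 0 0, Measure.map_apply hF (measurableSet_singleton s),
    Measure.restrict_apply (hF (measurableSet_singleton s)),
    Measure.map_apply (hY.prodMk hV) ((hF (measurableSet_singleton s)).inter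
      (measurableSet_Ioi.prod MeasurableSet.univ))]
  congr 1
  ext ω
  simp [and_comm]

variable {𝕜 : Type*} [RCLike 𝕜] {s : 𝕜}

theorem IsMarkedInput.integrable_pow_service (h : IsMarkedInput P Y V) (hF : Measurable F)
    (hp : 0 < P.real {ω | 0 < Y 0 ω})
    (hs : Integrable (fun k : ℕ => s ^ k) (P.map fun ω => markService Y V F ω 0)) :
    Integrable (fun x => s ^ F x) (((P.map (Y 0)).restrict (Set.Ioi 0)).prod (P.map (V 0))) := by
  have h1 : P {ω | 0 < Y 0 ω} ≠ 0 := fun h0 => by simp [measureReal_def, h0] at hp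
  rw [← integrable_smul_measure h1 (by finiteness), h.smul_map_service hF hp,
    integrable_map_measure (by fun_prop) hF.aemeasurable] at hs
  exact hs

theorem IsMarkedInput.pgf_service (h : IsMarkedInput P Y V) (hF : Measurable F)
    (hp : 0 < P.real {ω | 0 < Y 0 ω})
    (hs : Integrable (fun k : ℕ => s ^ k) (P.map fun ω => markService Y V F ω 0)) :
    (P.real {ω | 0 < Y 0 ω} : 𝕜) * ∫ k : ℕ, s ^ k ∂(P.map fun ω => markService Y V F ω 0) =
      ∫ y in Set.Ioi 0, ∫ v, s ^ F (y, v) ∂(P.map (V 0)) ∂(P.map (Y 0)) := by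
  have := Measure.isProbabilityMeasure_map (μ := P) (h.measurable_mark 0).aemeasurable
  have := Measure.isProbabilityMeasure_map (μ := P) (h.measurable_row 0).aemeasurable
  rw [← integral_prod _ (h.integrable_pow_service hF hp hs),
    ← integral_map (f := fun k : ℕ => s ^ k) hF.aemeasurable (by fun_prop),
    ← h.smul_map_service hF hp, integral_smul_measure, RCLike.real_smul_eq_coe_mul]
  rfl

/-- Passes integrability from the whole service to a part of it, such as one packet; this is what
keeps the denominators `1 - ε * s` and `1 - ε * s ^ n` nonzero. -/
theorem IsMarkedInput.integrable_pow_row (h : IsMarkedInput P Y V) (hF : Measurable F)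
    (hp : 0 < P.real {ω | 0 < Y 0 ω}) {f : E → ℕ} (hf : Measurable f)
    (hle : ∀ y v, 0 < y → f v ≤ F (y, v))
    (hs : Integrable (fun k : ℕ => s ^ k) (P.map fun ω => markService Y V F ω 0)) :
    Integrable (fun ω => s ^ f (V 0 ω)) P := by
  have := Measure.isProbabilityMeasure_map (μ := P) (h.measurable_mark 0).aemeasurable
  have := Measure.isProbabilityMeasure_map (μ := P) (h.measurable_row 0).aemeasurable
  have hne : (P.map (Y 0)).restrict (Set.Ioi 0) ≠ 0 := by
    rw [Ne, Measure.restrict_eq_zero, Measure.map_apply (h.measurable_mark 0) measurableSet_Ioi]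
    intro h0
    change P {ω | 0 < Y 0 ω} = 0 at h0
    simp [measureReal_def, h0] at hp
  have hpos : ∀ᵐ x ∂((P.map (Y 0)).restrict (Set.Ioi 0)).prod (P.map (V 0)), 0 < x.1 :=
    Measure.quasiMeasurePreserving_fst.ae (ae_restrict_mem measurableSet_Ioi)
  have h1 : Integrable (fun x : ℕ × E => s ^ f x.2)
      (((P.map (Y 0)).restrict (Set.Ioi 0)).prod (P.map (V 0))) :=
    integrable_pow_of_le (hf.comp measurable_snd).aemeasurable
      (by filter_upwards [hpos] with x hx using hle _ _ hx) (h.integrable_pow_service hF hp hs)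
  have h2 : Integrable (fun v => s ^ f v) (P.map (V 0)) :=
    (Integrable.comp_snd_iff (f := fun v => s ^ f v) hne).1 h1
  exact (integrable_map_measure
    ((measurable_of_countable fun k : ℕ => s ^ k).comp hf).aestronglyMeasurable
    (h.measurable_row 0).aemeasurable).1 h2

end ServiceLaw

/-! ### The two traffic models as marked inputs -/

section Models

theorem measurable_toNat : Measurable Bool.toNat := measurable_of_countable _

/-- The total service of the first `x.1` packets of a bulk with transmission counts `x.2`. -/
theorem measurable_sum_range : Measurable fun x : ℕ × (ℕ → ℕ) => ∑ k ∈ Finset.range x.1, x.2 k :=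
  measurable_from_prod_countable_right fun b =>
    Finset.measurable_sum (Finset.range b) fun k _ => measurable_pi_apply k

theorem measurable_frameCount (n t : ℕ) : Measurable fun a : ℕ → Bool => frameCount n a t :=
  Finset.measurable_sum _ fun _ _ => measurable_toNat.comp (measurable_pi_apply _)

variable {Ω ι : Type*} [MeasurableSpace Ω] {P : Measure Ω}
  {lam ε : ℝ} {arr : ℕ → Ω → Bool} {X : ι → Ω → ℕ}

namespace IsTrafficModel

theorem measureReal_mark_pos_async (h : IsTrafficModel P lam ε arr X) :
    P.real {ω | 0 < (arr 0 ω).toNat} = lam := by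
  rw [← h.bernoulli 0]
  congr 1
  ext ω
  cases hω : arr 0 ω <;> simp [hω]

theorem integral_pow_sum_row {𝕜 : Type*} [RCLike 𝕜] {X : ℕ × ℕ → Ω → ℕ}
    (h : IsTrafficModel P lam ε arr X) {s g : 𝕜}
    (hg : ∀ k, ∫ ω, s ^ X (0, k) ω ∂P = g) (b : ℕ) :
    ∫ v : ℕ → ℕ, s ^ ∑ k ∈ Finset.range b, v k ∂(P.map fun ω k => X (0, k) ω) = g ^ b := by
  have hV : Measurable fun ω k => X (0, k) ω := measurable_pi_lambda _ fun k => h.measurable_X _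
  have hm : Measurable fun v : ℕ → ℕ => s ^ ∑ k ∈ Finset.range b, v k :=
    (measurable_of_countable fun k : ℕ => s ^ k).comp (by fun_prop)
  rw [integral_map hV.aemeasurable hm.aestronglyMeasurable]
  have hinj : Function.Injective fun k : Fin b => ((0, k) : ℕ × ℕ) := fun k k' hk => by
    simpa [Fin.ext_iff] using hk
  have h1 : ∀ ω, s ^ ∑ k ∈ Finset.range b, X (0, k) ω = ∏ k : Fin b, s ^ X (0, k) ω := fun ω => by
    rw [← Finset.prod_pow_eq_pow_sum, Finset.prod_range]
  simp_rw [h1]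
  rw [(h.indep_X.precomp hinj).integral_fun_prod_comp (f := fun (_ : Fin b) (k : ℕ) => s ^ k)
    (fun k => (h.measurable_X _).aemeasurable) fun k => by fun_prop]
  simp [hg]

variable [IsProbabilityMeasure P]

theorem map_arr (h : IsTrafficModel P lam ε arr X) (c : ℕ) : P.map (arr c) = P.map (arr 0) := by
  have h1 : ∀ c, P.map (arr c) {true} = ENNReal.ofReal lam := fun c => by
    rw [Measure.map_apply (h.measurable_arr c) (measurableSet_singleton _), ← h.bernoulli c,
      ofReal_measureReal]
    rfl
  have := fun c => Measure.isProbabilityMeasure_map (μ := P) (h.measurable_arr c).aemeasurable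
  have h2 : ∀ c, P.map (arr c) {false} = 1 - ENNReal.ofReal lam := fun c => by
    rw [← h1 c, ← prob_compl_eq_one_sub (measurableSet_singleton _)]
    congr 1
    ext b
    cases b <;> simp
  refine Measure.ext_of_singleton fun b => ?_
  cases b
  · rw [h2, h2]
  · rw [h1, h1]

theorem isGeometric_map (h : IsTrafficModel P lam ε arr X) (hε : 0 < ε) (hε1 : ε < 1) (i : ι) :
    IsGeometric (1 - ε) (P.map (X i)) where
  isProbabilityMeasure := Measure.isProbabilityMeasure_map (h.measurable_X i).aemeasurable
  pos := by linarith
  lt_one := by linarith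
  apply_succ k := by
    rw [measureReal_def, Measure.map_apply (h.measurable_X i) (measurableSet_singleton _),
      sub_sub_cancel, ← h.geometric i k]
    rfl

theorem map_X (h : IsTrafficModel P lam ε arr X)
    (hε : 0 < ε) (hε1 : ε < 1) (i j : ι) : P.map (X i) = P.map (X j) := by
  have hi := h.isGeometric_map hε hε1 i
  have hj := h.isGeometric_map hε hε1 j
  have := hi.isProbabilityMeasure
  have := hj.isProbabilityMeasure
  refine Measure.ext_of_singleton fun k => ?_
  cases k with
  | zero => rw [hi.apply_zero, hj.apply_zero]
  | succ k =>
    rw [← ENNReal.toReal_eq_toReal_iff' (by finiteness) (by finiteness)]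
    exact (hi.apply_succ k).trans (hj.apply_succ k).symm

variable {𝕜 : Type*} [RCLike 𝕜]

theorem integral_pow_arr (h : IsTrafficModel P lam ε arr X)
    (z : 𝕜) (c : ℕ) : ∫ ω, z ^ (arr c ω).toNat ∂P = 1 - lam + lam * z := by
  have := Measure.isProbabilityMeasure_map (μ := P) (h.measurable_arr c).aemeasurable
  have h1 : (P.map (arr c)).real {true} = lam := by
    rw [measureReal_def, Measure.map_apply (h.measurable_arr c) (measurableSet_singleton _),
      ← h.bernoulli c]
    rfl
  have h2 : (P.map (arr c)).real {false} = 1 - lam := by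
    rw [← h1, ← probReal_compl_eq_one_sub (measurableSet_singleton _)]
    congr 1
    ext b
    cases b <;> simp
  rw [← integral_map (f := fun b : Bool => z ^ b.toNat) (h.measurable_arr c).aemeasurable
    (by fun_prop), integral_fintype .of_finite]
  simp [h1, h2, RCLike.real_smul_eq_coe_mul]
  ring

theorem integral_pow_X (h : IsTrafficModel P lam ε arr X) (hε : 0 < ε) (hε1 : ε < 1) {z : 𝕜} {i : ι}
    (hz : Integrable (fun ω => z ^ X i ω) P) :
    1 - (ε : 𝕜) * z ≠ 0 ∧ ∫ ω, z ^ X i ω ∂P = (1 - ε) * z / (1 - ε * z) := by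
  have hγ := h.isGeometric_map hε hε1 i
  have hz' : Integrable (fun k : ℕ => z ^ k) (P.map (X i)) :=
    (integrable_map_measure (by fun_prop) (h.measurable_X i).aemeasurable).2 hz
  have h1 := hγ.one_sub_mul_ne_zero hz'
  have h2 := hγ.integral_pow hz'
  rw [sub_sub_cancel] at h1 h2
  refine ⟨h1, ?_⟩
  rw [integral_map (h.measurable_X i).aemeasurable (by fun_prop)] at h2
  rw [eq_div_iff h1, mul_comm, h2]
  push_cast
  ring

/-! #### Frame-asynchronous model -/

section Async

variable {X : ℕ → Ω → ℕ}

theorem isMarkedInput_async (h : IsTrafficModel P lam ε arr X) (hε : 0 < ε) (hε1 : ε < 1) :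
    IsMarkedInput P (fun c ω => (arr c ω).toNat) X where
  measurable_mark c := measurable_toNat.comp (h.measurable_arr c)
  measurable_row := h.measurable_X
  indep_mark := h.indep_arr.comp (fun _ => Bool.toNat) fun _ => measurable_of_countable _
  indep_row := h.indep_X
  indep := h.indep.comp (φ := fun a c => (a c).toNat) (ψ := id)
    (measurable_pi_lambda _ fun c => measurable_toNat.comp (measurable_pi_apply c))
    measurable_id
  map_mark c := by
    have h1 : ∀ c, P.map (fun ω => (arr c ω).toNat) = (P.map (arr c)).map Bool.toNat := fun c =>
      (Measure.map_map measurable_toNat (h.measurable_arr c)).symm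
    rw [h1, h1, h.map_arr]
  map_row i := h.map_X hε hε1 i 0

variable {𝕜 : Type*} [RCLike 𝕜] {s : 𝕜}

theorem pgf_service_async (h : IsTrafficModel P lam ε arr X)
    (hlam : 0 < lam) (hε : 0 < ε) (hε1 : ε < 1) (n : ℕ)
    (hs : Integrable (fun k : ℕ => s ^ k) (P.map fun ω =>
      markService (fun c ω => (arr c ω).toNat) X (fun x : ℕ × ℕ => n * x.2) ω 0)) :
    1 - (ε : 𝕜) * s ^ n ≠ 0 ∧
      ∫ k : ℕ, s ^ k ∂(P.map fun ω =>
        markService (fun c ω => (arr c ω).toNat) X (fun x : ℕ × ℕ => n * x.2) ω 0) =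
      (1 - ε) * s ^ n / (1 - ε * s ^ n) := by
  have hI := h.isMarkedInput_async hε hε1
  have hp := h.measureReal_mark_pos_async
  have hF : Measurable fun x : ℕ × ℕ => n * x.2 := by fun_prop
  have hX : Integrable (fun ω => (s ^ n) ^ X 0 ω) P := by
    simpa [pow_mul] using hI.integrable_pow_row hF (hp ▸ hlam) (f := fun v => n * v) (by fun_prop)
      (fun _ _ _ => le_rfl) hs
  obtain ⟨hne, hX'⟩ := h.integral_pow_X hε hε1 hX
  refine ⟨hne, ?_⟩
  have h1 := hI.pgf_service hF (hp ▸ hlam) hs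
  have h2 : ∫ v, s ^ (n * v) ∂(P.map (X 0)) = (1 - ε) * s ^ n / (1 - ε * s ^ n) := by
    rw [integral_map (h.measurable_X 0).aemeasurable (by fun_prop), ← hX']
    simp [pow_mul]
  have h3 : (P.map fun ω => (arr 0 ω).toNat).real (Set.Ioi 0) = lam := by
    rw [measureReal_def, Measure.map_apply (hI.measurable_mark 0) measurableSet_Ioi, ← hp]
    rfl
  simp only [h2, hp, setIntegral_const, h3, RCLike.real_smul_eq_coe_mul] at h1
  exact mul_left_cancel₀ (by exact_mod_cast hlam.ne') h1

end Async

/-! #### Frame-synchronous model -/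

section Sync

variable {X : ℕ × ℕ → Ω → ℕ}

theorem isMarkedInput_sync (h : IsTrafficModel P lam ε arr X)
    (hε : 0 < ε) (hε1 : ε < 1) {n : ℕ} (hn : 0 < n) :
    IsMarkedInput P (fun t ω => frameCount n (fun c => arr c ω) t)
      (fun m ω k => X (m, k) ω) := by
  -- Division with remainder by `n`: the frames are the rows of the arrivals rearranged as a doubly
  -- indexed family.
  have hinj : Function.Injective fun x : ℕ × Fin n => x.1 * n + x.2 := by
    have : NeZero n := ⟨hn.ne'⟩
    exact (Nat.divModEquiv n).symm.injective
  have hU := h.indep_arr.precomp hinj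
  have hUm : ∀ x : ℕ × Fin n, Measurable ((arr ∘ fun x : ℕ × Fin n => x.1 * n + x.2) x) :=
    fun x => h.measurable_arr _
  have hsum : Measurable fun v : Fin n → Bool => ∑ j, (v j).toNat :=
    Finset.measurable_sum _ fun j _ => measurable_toNat.comp (measurable_pi_apply j)
  have hY : ∀ t, (fun ω => frameCount n (fun c => arr c ω) t) =
      (fun v : Fin n → Bool => ∑ j, (v j).toNat) ∘ fun ω j => arr (t * n + j) ω := fun t => by
    funext ω
    exact Finset.sum_range fun j => (arr (t * n + j) ω).toNat
  have hYm : ∀ t, Measurable fun ω => frameCount n (fun c => arr c ω) t := fun t =>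
    (measurable_frameCount n t).comp (measurable_pi_lambda _ h.measurable_arr)
  refine ⟨hYm, fun m => measurable_pi_lambda _ fun k => h.measurable_X _, ?_,
    iIndepFun_rows h.indep_X h.measurable_X, ?_, fun t => ?_, fun m => ?_⟩
  · have := (iIndepFun_rows hU hUm).comp (fun _ => fun v : Fin n → Bool => ∑ j, (v j).toNat)
      fun _ => hsum
    rw [funext hY]
    exact this
  · refine h.indep.comp (φ := fun a t => frameCount n a t) (ψ := fun x m k => x (m, k)) ?_ ?_
    · exact measurable_pi_lambda _ fun t => measurable_frameCount n t
    · fun_prop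
  · have h1 : ∀ t, P.map (fun ω => frameCount n (fun c => arr c ω) t) =
        (Measure.infinitePi fun _ : Fin n => P.map (arr 0)).map fun v => ∑ j, (v j).toNat :=
      fun t => by
        rw [hY, ← Measure.map_map hsum (measurable_pi_lambda _ fun j => h.measurable_arr _),
          ← map_row_eq hU hUm
          (fun x => h.map_arr _) t]
    rw [h1, h1]
  · rw [map_row_eq h.indep_X h.measurable_X (fun i => h.map_X hε hε1 i 0),
      map_row_eq h.indep_X h.measurable_X (fun i => h.map_X hε hε1 i 0)]

variable {𝕜 : Type*} [RCLike 𝕜] {s : 𝕜} {n : ℕ}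

theorem integral_pow_frameCount (h : IsTrafficModel P lam ε arr X) (n : ℕ) (z : 𝕜) :
    ∫ ω, z ^ frameCount n (fun c => arr c ω) 0 ∂P = (1 - lam + lam * z) ^ n := by
  have h1 : ∀ ω, z ^ frameCount n (fun c => arr c ω) 0 = ∏ j : Fin n, z ^ (arr j ω).toNat :=
    fun ω => by
      rw [frameCount, ← Finset.prod_pow_eq_pow_sum, Finset.prod_range]
      simp
  simp_rw [h1]
  rw [(h.indep_arr.precomp Fin.val_injective).integral_fun_prod_comp
    (f := fun (j : Fin n) (b : Bool) => z ^ b.toNat)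
    (fun j => (h.measurable_arr _).aemeasurable) fun j => by fun_prop]
  simp [h.integral_pow_arr]

theorem setIntegral_pow_frameCount (h : IsTrafficModel P lam ε arr X) (n : ℕ) (z : 𝕜) :
    ∫ y in Set.Ioi 0, z ^ y ∂(P.map fun ω => frameCount n (fun c => arr c ω) 0) =
      (1 - lam + lam * z) ^ n - (1 - lam) ^ n := by
  have hYm : Measurable fun ω => frameCount n (fun c => arr c ω) 0 :=
    (measurable_frameCount n 0).comp (measurable_pi_lambda _ h.measurable_arr)
  have hle : ∀ ω, frameCount n (fun c => arr c ω) 0 ≤ n := fun ω =>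
    (Finset.sum_le_card_nsmul _ _ 1 fun j _ => Bool.toNat_le _).trans (by simp)
  have hint : ∀ z : 𝕜, Integrable (fun ω => z ^ frameCount n (fun c => arr c ω) 0) P := fun z =>
    Integrable.of_bound
      ((measurable_of_countable fun k : ℕ => z ^ k).comp hYm).aestronglyMeasurable
      (max 1 ‖z‖ ^ n) (ae_of_all _ fun ω => norm_pow_le_max_one_pow (hle ω))
  -- Since `0 ^ 0 = 1`, removing empty frames means subtracting the PGF at `0`.
  have h1 : (Set.Ioi 0).indicator (fun y : ℕ => z ^ y) = fun y => z ^ y - 0 ^ y := by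
    funext y
    rcases Nat.eq_zero_or_pos y with rfl | hy
    · simp
    · simp [hy, hy.ne']
  rw [← integral_indicator measurableSet_Ioi, h1, integral_map hYm.aemeasurable (by fun_prop),
    integral_sub (hint _) (hint _), h.integral_pow_frameCount n, h.integral_pow_frameCount n]
  simp

theorem measureReal_mark_pos_sync (h : IsTrafficModel P lam ε arr X) (n : ℕ) :
    P.real {ω | 0 < frameCount n (fun c => arr c ω) 0} = 1 - (1 - lam) ^ n := by
  have hYm : Measurable fun ω => frameCount n (fun c => arr c ω) 0 :=
    (measurable_frameCount n 0).comp (measurable_pi_lambda _ h.measurable_arr)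
  have h1 := h.setIntegral_pow_frameCount n (1 : ℝ)
  simp only [one_pow, integral_const, MeasurableSet.univ, measureReal_restrict_apply,
    Set.univ_inter, smul_eq_mul, mul_one, RCLike.ofReal_real_eq_id, id_eq] at h1
  rw [measureReal_def, Measure.map_apply hYm measurableSet_Ioi] at h1
  rw [measureReal_def]
  refine h1.trans ?_
  ring_nf

theorem pgf_service_sync (h : IsTrafficModel P lam ε arr X)
    (hlam : 0 < lam) (hlam1 : lam < 1) (hε : 0 < ε) (hε1 : ε < 1)
    (hn : 0 < n) (hs : Integrable (fun k : ℕ => s ^ k) (P.map fun ω =>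
      markService (fun t ω => frameCount n (fun c => arr c ω) t) (fun m ω k => X (m, k) ω)
        (fun x : ℕ × (ℕ → ℕ) => ∑ k ∈ Finset.range x.1, x.2 k) ω 0)) :
    1 - (ε : 𝕜) * s ≠ 0 ∧ (1 - (1 - lam) ^ n) * ∫ k : ℕ, s ^ k ∂(P.map fun ω =>
      markService (fun t ω => frameCount n (fun c => arr c ω) t) (fun m ω k => X (m, k) ω)
        (fun x : ℕ × (ℕ → ℕ) => ∑ k ∈ Finset.range x.1, x.2 k) ω 0) =
      ((1 - lam + (lam - ε) * s) / (1 - ε * s)) ^ n - (1 - lam) ^ n := by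
  have hI := h.isMarkedInput_sync hε hε1 hn
  have hp := h.measureReal_mark_pos_sync n
  have hp0 : 0 < 1 - (1 - lam) ^ n :=
    sub_pos.2 (pow_lt_one₀ (by linarith) (by linarith) hn.ne')
  have hX0 : Integrable (fun ω => s ^ X (0, 0) ω) P :=
    hI.integrable_pow_row measurable_sum_range (hp ▸ hp0) (f := fun v => v 0) (by fun_prop)
      (fun y v hy => Finset.single_le_sum (f := v) (fun _ _ => Nat.zero_le _)
        (Finset.mem_range.2 hy)) hs
  have hX : ∀ k, Integrable (fun ω => s ^ X (0, k) ω) P := fun k => by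
    refine (integrable_map_measure (f := X (0, k)) (g := fun k : ℕ => s ^ k) (by fun_prop)
      (h.measurable_X _).aemeasurable).1 ?_
    rw [h.map_X hε hε1 (0, k) (0, 0)]
    exact (integrable_map_measure (by fun_prop) (h.measurable_X _).aemeasurable).2 hX0
  have hne := (h.integral_pow_X hε hε1 hX0).1
  refine ⟨hne, ?_⟩
  have h1 := hI.pgf_service measurable_sum_range (hp ▸ hp0) hs
  simp only [h.integral_pow_sum_row fun k => (h.integral_pow_X hε hε1 (hX k)).2,
    h.setIntegral_pow_frameCount n, hp] at h1
  push_cast at h1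
  rw [h1]
  congr 2
  field_simp
  ring

end Sync

end IsTrafficModel

end Models

/-! ### Steady state from a service PGF in closed form -/

section SteadyState

variable {Ω E : Type*} [MeasurableSpace Ω] [MeasurableSpace E] {P : Measure Ω}
  [IsProbabilityMeasure P] {Y : ℕ → Ω → ℕ} {V : ℕ → Ω → E} {F : ℕ × E → ℕ}

theorem integral_pow_pos (μ : Measure ℕ) [IsProbabilityMeasure μ] {a : ℝ} (h0 : 0 < a)
    (h1 : a ≤ 1) : 0 < ∫ k : ℕ, a ^ k ∂μ := by
  rw [integral_pos_iff_support_of_nonneg (fun k => pow_nonneg h0.le k)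
    (integrable_pow_of_norm_le_one (by rwa [Real.norm_of_nonneg h0.le]))]
  rw [show (Function.support fun k : ℕ => a ^ k) = Set.univ from
    Set.eq_univ_of_forall fun k => (pow_pos h0 k).ne']
  simp

/-- The mean service enters only as the left slope of its PGF at `1`. It is computed as the
derivative of a closed form `R` that agrees with the PGF on `(0, 1)`. -/
theorem tendsto_one_sub_div_of_hasDerivAt {G R : ℝ → ℝ} {M : ℝ} (hR : HasDerivAt R M 1)
    (hR1 : R 1 = 1) (hG : ∀ s, 0 < s → s < 1 → G s = R s) :
    Tendsto (fun s : ℝ => (1 - G s) / (1 - s)) (𝓝[<] 1) (𝓝 M) := by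
  refine ((hasDerivAt_iff_tendsto_slope.1 hR).mono_left
    (nhdsWithin_mono 1 fun s (hs : s < 1) => hs.ne)).congr' ?_
  filter_upwards [eventually_nhdsLT_one zero_lt_one] with s hs
  rw [slope_def_field, hR1, hG s hs.1 hs.2, ← neg_sub 1 (R s), ← neg_sub 1 s, neg_div_neg_eq]

/-- The steady state of a stable queue and its generating functions in terms of the generating
function of the service time. -/
theorem IsMarkedInput.exists_steady_state_pgf (h : IsMarkedInput P Y V) (hF : Measurable F)
    {p M : ℝ} (hp0 : 0 < p) (hp1 : p < 1) (hp : P.real {ω | 0 < Y 0 ω} = p) {R : ℝ → ℝ}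
    (hR : HasDerivAt R M 1) (hR1 : R 1 = 1)
    (hG : ∀ s : ℝ, 0 < s → s < 1 →
      ∫ k : ℕ, s ^ k ∂(P.map fun ω => markService Y V F ω 0) = R s) (hpM : p * M < 1) :
    ∃ πD πA : Measure ℕ,
      IsSteadyState P (fun m ω => delay (markArrival Y ω) (markService Y V F ω) m) πD ∧
      IsSteadyState P (fun m ω => peakAge (markArrival Y ω) (markService Y V F ω) m) πA ∧
      πA = (πD.prod P).map (fun x : ℕ × Ω =>
        max x.1 (markArrival Y x.2 1 - markArrival Y x.2 0) + markService Y V F x.2 0) ∧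
      (∀ s : ℂ, s ≠ 1 → Integrable (fun k : ℕ => s ^ k) πD →
        Integrable (fun k : ℕ => s ^ k) (P.map fun ω => markService Y V F ω 0) ∧
        s - (1 - p : ℝ) - p * pgf (P.map fun ω => markService Y V F ω 0) s ≠ 0 ∧
        pgf πD s = ((1 - p * M : ℝ) : ℂ) * (s - 1) *
          pgf (P.map fun ω => markService Y V F ω 0) s /
            (s - (1 - p : ℝ) - p * pgf (P.map fun ω => markService Y V F ω 0) s)) ∧
      (∀ s : ℂ, Integrable (fun k : ℕ => s ^ k) πA →
        Integrable (fun k : ℕ => s ^ k) πD ∧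
        Integrable (fun k : ℕ => s ^ k) (P.map fun ω => markService Y V F ω 0) ∧
        Integrable (fun k : ℕ => (((1 - p : ℝ) : ℂ) * s) ^ k) πD ∧
        ((1 - p : ℝ) : ℂ) * s ≠ 1 ∧
        pgf πA s = pgf (P.map fun ω => markService Y V F ω 0) s *
          (pgf πD s - (1 - s) * pgf πD (((1 - p : ℝ) : ℂ) * s) / (1 - ((1 - p : ℝ) : ℂ) * s))) := by
  obtain ⟨πD, πA, hD, hA, hAeq, hstat, hnorm, hpeak⟩ := h.exists_isSteadyState hF hp0 hp1 hp
    (tendsto_one_sub_div_of_hasDerivAt hR hR1 hG) hpM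
  have hγ := h.isGeometric_gap hp0 hp1 hp
  have := hγ.isProbabilityMeasure
  have := Measure.isProbabilityMeasure_map (μ := P) (h.measurable_markService hF 0).aemeasurable
  have := hD.isProbabilityMeasure
  refine ⟨πD, πA, hD, hA, hAeq, fun s hs1 hs => ?_, fun s hs => ?_⟩
  · have h1 := pgf_stationary hγ hstat (integral_pow_pos _ (by linarith) (by linarith))
      (by rw [hnorm]; linarith) hs1 hs
    rwa [hnorm] at h1
  · rw [hpeak] at hs
    obtain ⟨h1, h2, h3, h4, h5⟩ := pgf_peakLaw hγ hs
    refine ⟨h1, h2, integrable_pow_of_norm_le_one ?_, fun h0 => h4 ?_, ?_⟩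
    · rw [norm_mul, Complex.norm_real, Real.norm_of_nonneg (by linarith)]
      exact h3.le
    · exact sub_eq_zero.2 h0.symm
    · rw [hpeak]
      exact h5

end SteadyState

/-! ### Mean service times and algebra of the closed forms -/

section ClosedForms

theorem hasDerivAt_asyncService {ε : ℝ} (hε1 : ε < 1) (n : ℕ) :
    HasDerivAt (fun s : ℝ => (1 - ε) * s ^ n / (1 - ε * s ^ n)) (n / (1 - ε)) 1 := by
  have hne : 1 - ε ≠ 0 := by linarith
  have h1 := hasDerivAt_pow (𝕜 := ℝ) n 1
  have h2 := (h1.const_mul (1 - ε)).div ((h1.const_mul ε).const_sub 1) (by simpa using hne)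
  refine h2.congr_deriv ?_
  simp only [one_pow, mul_one]
  field_simp
  ring

theorem hasDerivAt_syncService {lam ε : ℝ} (hε1 : ε < 1) (n : ℕ) :
    HasDerivAt (fun s : ℝ => (((1 - lam + (lam - ε) * s) / (1 - ε * s)) ^ n - (1 - lam) ^ n) /
      (1 - (1 - lam) ^ n)) (lam * n / (1 - ε) / (1 - (1 - lam) ^ n)) 1 := by
  have hne : 1 - ε ≠ 0 := by linarith
  have h1 := (((hasDerivAt_id (1 : ℝ)).const_mul (lam - ε)).const_add (1 - lam)).div
    (((hasDerivAt_id (1 : ℝ)).const_mul ε).const_sub 1) (by simpa using hne)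
  refine (((h1.pow n).sub_const _).div_const _).congr_deriv ?_
  simp only [id, mul_one, Pi.div_apply]
  rw [show 1 - lam + (lam - ε) = 1 - ε by ring, div_self hne, one_pow]
  congr 1
  field_simp
  ring

/-- Numerator and denominator are both cleared by `(1 - ε * s) ^ n`, which is nonzero wherever the
service PGF converges. -/
theorem syncDelayPGF_eq {n : ℕ} {lam ε : ℝ} {s G : ℂ} (hp : (1 : ℂ) - (1 - lam) ^ n ≠ 0)
    (hne : 1 - ε * s ≠ 0)
    (hG : (1 - (1 - lam) ^ n) * G =
      ((1 - lam + (lam - ε) * s) / (1 - ε * s)) ^ n - (1 - lam) ^ n)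
    (hden : s - (1 - lam) ^ n - (1 - (1 - lam) ^ n) * G ≠ 0) :
    (1 - lam * n / (1 - ε)) * (s - 1) * G / (s - (1 - lam) ^ n - (1 - (1 - lam) ^ n) * G) =
      syncDelayPGF n lam ε s := by
  have hc : (1 - ε * s) ^ n ≠ 0 := pow_ne_zero _ hne
  have hB : (1 - lam + (lam - ε) * s) ^ n =
      (1 - ε * s) ^ n * ((1 - (1 - lam) ^ n) * G + (1 - lam) ^ n) := by
    rw [hG, div_pow]
    field_simp
    ring
  have hden' : s * (1 - ε * s) ^ n - (1 - lam + (lam - ε) * s) ^ n =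
      (1 - ε * s) ^ n * (s - (1 - lam) ^ n - (1 - (1 - lam) ^ n) * G) := by
    rw [hB]; ring
  have hnum : (1 - lam) ^ n * (1 - ε * s) ^ n - (1 - lam + (lam - ε) * s) ^ n =
      -((1 - ε * s) ^ n * ((1 - (1 - lam) ^ n) * G)) := by
    rw [hB]; ring
  rw [syncDelayPGF, hden', hnum]
  generalize (1 - ε * s) ^ n = c at hc
  generalize 1 - (lam : ℂ) * n / (1 - ε) = κ
  rw [mul_assoc κ, mul_div_assoc κ]
  congr 1
  rw [div_eq_div_iff hden (mul_ne_zero hp (mul_ne_zero hc hden))]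
  ring

theorem asyncDelayPGF_eq {n : ℕ} {lam ε : ℝ} {s G : ℂ} (hε1 : (1 : ℂ) - ε ≠ 0)
    (hne : 1 - ε * s ^ n ≠ 0) (hG : G = (1 - ε) * s ^ n / (1 - ε * s ^ n))
    (hden : s - (1 - lam) - lam * G ≠ 0) :
    (1 - lam * n / (1 - ε)) * (s - 1) * G / (s - (1 - lam) - lam * G) =
      asyncDelayPGF n lam ε s := by
  have hG' : (1 - ε * s ^ n) * G = (1 - ε) * s ^ n := by rw [hG]; field_simp
  have hden' : s - (1 - lam) - (lam + ε * (s - 1)) * s ^ n =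
      (1 - ε * s ^ n) * (s - (1 - lam) - lam * G) := by
    linear_combination lam * hG'
  rw [asyncDelayPGF, hden', div_eq_div_iff hden (mul_ne_zero hne hden)]
  have hκ : (1 - (lam : ℂ) * n / (1 - ε)) * (1 - ε) = 1 - ε - lam * n := by field_simp
  rw [← hκ]
  linear_combination (1 - (lam : ℂ) * n / (1 - ε)) * (s - 1) * (s - (1 - lam) - lam * G) * hG'

end ClosedForms

end PeakAge

/-! ### The two models -/

theorem theorem4 {Ω : Type*} [MeasurableSpace Ω] (P : MeasureTheory.Measure Ω)
    [MeasureTheory.IsProbabilityMeasure P]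
    (n : ℕ) (hn : 0 < n) (lam ε : ℝ) (hlam : 0 < lam) (hε : 0 < ε) (hstable : lam * n < 1 - ε) :
    -- frame-synchronous model (time unit: frame)
    (∀ (arr : ℕ → Ω → Bool) (X : ℕ × ℕ → Ω → ℕ), PeakAge.IsTrafficModel P lam ε arr X →
      let α : Ω → ℕ → ℕ := fun ω => PeakAge.bulkArrival n (fun c => arr c ω)
      let S : Ω → ℕ → ℕ := fun ω => PeakAge.bulkService n (fun c => arr c ω) (fun i => X i ω)
      ∃ πD πA : MeasureTheory.Measure ℕ,
        PeakAge.IsSteadyState P (fun m ω => PeakAge.delay (α ω) (S ω) m) πD ∧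
        PeakAge.IsSteadyState P (fun m ω => PeakAge.peakAge (α ω) (S ω) m) πA ∧
        -- `πA` is the law of `max (D, α₂ - α₁) + S₁` with `D ∼ πD` independent of `(α₂ - α₁, S₁)`
        πA = (πD.prod P).map (fun p : ℕ × Ω => max p.1 (α p.2 1 - α p.2 0) + S p.2 0) ∧
        (∀ s : ℂ, s ≠ 1 → MeasureTheory.Integrable (fun k : ℕ => s ^ k) πD →
          PeakAge.pgf πD s = PeakAge.syncDelayPGF n lam ε s) ∧
        (∀ s : ℂ, s ≠ 1 → MeasureTheory.Integrable (fun k : ℕ => s ^ k) πA →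
          PeakAge.pgf πA s =
            (((1 - lam + (lam - ε) * s) ^ n - (1 - ε * s) ^ n * (1 - lam) ^ n) /
              ((1 - ε * s) ^ n * (1 - (1 - lam) ^ n))) *
            (PeakAge.syncDelayPGF n lam ε s -
              (1 - s) * PeakAge.syncDelayPGF n lam ε ((1 - lam) ^ n * s) /
                (1 - (1 - lam) ^ n * s)))) ∧
    -- frame-asynchronous model (time unit: channel use)
    (∀ (arr : ℕ → Ω → Bool) (X : ℕ → Ω → ℕ), PeakAge.IsTrafficModel P lam ε arr X →
      let α : Ω → ℕ → ℕ := fun ω => PeakAge.packetArrival (fun c => arr c ω)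
      let S : Ω → ℕ → ℕ := fun ω => PeakAge.packetService n (fun i => X i ω)
      ∃ πD πA : MeasureTheory.Measure ℕ,
        PeakAge.IsSteadyState P (fun m ω => PeakAge.delay (α ω) (S ω) m) πD ∧
        PeakAge.IsSteadyState P (fun m ω => PeakAge.peakAge (α ω) (S ω) m) πA ∧
        πA = (πD.prod P).map (fun p : ℕ × Ω => max p.1 (α p.2 1 - α p.2 0) + S p.2 0) ∧
        (∀ s : ℂ, s ≠ 1 → MeasureTheory.Integrable (fun k : ℕ => s ^ k) πD →
          PeakAge.pgf πD s = PeakAge.asyncDelayPGF n lam ε s) ∧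
        (∀ s : ℂ, s ≠ 1 → MeasureTheory.Integrable (fun k : ℕ => s ^ k) πA →
          PeakAge.pgf πA s =
            ((1 - ε) * s ^ n / (1 - ε * s ^ n)) *
            (PeakAge.asyncDelayPGF n lam ε s -
              (1 - s) * PeakAge.asyncDelayPGF n lam ε ((1 - lam) * s) /
                (1 - (1 - lam) * s)))) := by
  have hn1 : (1 : ℝ) ≤ n := by exact_mod_cast hn
  have hε1 : ε < 1 := by nlinarith
  have hlam1 : lam < 1 := by nlinarith
  have hεne : (1 : ℂ) - ε ≠ 0 := by
    have : (1 : ℝ) - ε ≠ 0 := by linarith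
    exact_mod_cast this
  have hload : lam * n / (1 - ε) < 1 := by rwa [div_lt_one (by linarith)]
  constructor
  · intro arr X h
    have hp0 : 0 < 1 - (1 - lam) ^ n :=
      sub_pos.2 (pow_lt_one₀ (by linarith) (by linarith) hn.ne')
    have hp0' : (1 : ℂ) - (1 - lam) ^ n ≠ 0 := by exact_mod_cast hp0.ne'
    have hp1 : 1 - (1 - lam) ^ n < 1 := by
      have : 0 < (1 - lam) ^ n := pow_pos (by linarith) n
      linarith
    -- The mean bulk service is conditioned on a nonempty frame; multiplying by that probability
    -- leaves the load `lam * n / (1 - ε)`.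
    have hM : (1 - (1 - lam) ^ n) * (lam * n / (1 - ε) / (1 - (1 - lam) ^ n)) =
        lam * n / (1 - ε) := mul_div_cancel₀ _ hp0.ne'
    have hI := h.isMarkedInput_sync hε hε1 hn
    obtain ⟨πD, πA, hD, hA, hAeq, hGD, hGA⟩ := hI.exists_steady_state_pgf
      PeakAge.measurable_sum_range hp0 hp1 (h.measureReal_mark_pos_sync n)
      (PeakAge.hasDerivAt_syncService (lam := lam) hε1 n)
      (by
        have hne : (1 : ℝ) - ε ≠ 0 := by linarith
        rw [mul_one, mul_one, show 1 - lam + (lam - ε) = 1 - ε by ring, div_self hne, one_pow,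
          div_self hp0.ne'])
      (fun s hs0 hs1 => by
        have := PeakAge.integrable_pow_of_norm_le_one (s := s)
          (μ := P.map fun ω => PeakAge.markService
            (fun t ω => PeakAge.frameCount n (fun c => arr c ω) t) (fun m ω k => X (m, k) ω)
            (fun x : ℕ × (ℕ → ℕ) => ∑ k ∈ Finset.range x.1, x.2 k) ω 0)
          (by rw [Real.norm_of_nonneg hs0.le]; exact hs1.le)
        have h1 := (h.pgf_service_sync hlam hlam1 hε hε1 hn this).2
        rw [eq_div_iff hp0.ne', mul_comm]
        exact h1)
      (by rwa [hM])
    have key : ∀ s : ℂ, s ≠ 1 → MeasureTheory.Integrable (fun k : ℕ => s ^ k) πD →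
        PeakAge.pgf πD s = PeakAge.syncDelayPGF n lam ε s := fun s hs1 hs => by
      obtain ⟨h1, h2, h3⟩ := hGD s hs1 hs
      obtain ⟨h4, h5⟩ := h.pgf_service_sync hlam hlam1 hε hε1 hn h1
      rw [hM] at h3
      rw [sub_sub_cancel] at h2 h3
      push_cast at h2 h3
      rw [h3]
      exact PeakAge.syncDelayPGF_eq hp0' h4 h5 h2
    refine ⟨πD, πA, hD, hA, hAeq, key, fun s hs1 hs => ?_⟩
    obtain ⟨h1, h2, h3, h4, h5⟩ := hGA s hs
    obtain ⟨h6, h7⟩ := h.pgf_service_sync hlam hlam1 hε hε1 hn h2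
    rw [h5, key s hs1 h1, key _ h4 h3, sub_sub_cancel]
    push_cast
    congr 1
    have hc : (1 - ε * s) ^ n ≠ 0 := pow_ne_zero _ h6
    rw [eq_div_iff (mul_ne_zero hc hp0'), mul_comm, mul_assoc]
    refine (congrArg _ h7).trans ?_
    rw [div_pow, mul_sub]
    exact congrArg (· - _) (mul_div_cancel₀ _ hc)
  · intro arr X h
    have hI := h.isMarkedInput_async hε hε1
    -- The abstract queue detects arrivals by a positive mark, the model by a Boolean; the arrival
    -- slots coincide.
    have hα : ∀ ω, PeakAge.markArrival (fun c ω => (arr c ω).toNat) ω =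
        PeakAge.packetArrival (fun c => arr c ω) := fun ω => by
      funext m
      simp only [PeakAge.markArrival, PeakAge.packetArrival]
      congr 1
      funext c
      cases arr c ω <;> simp
    have hM : lam * (n / (1 - ε)) = lam * n / (1 - ε) := by ring
    obtain ⟨πD, πA, hD, hA, hAeq, hGD, hGA⟩ := hI.exists_steady_state_pgf
      (F := fun x : ℕ × ℕ => n * x.2) (by fun_prop) hlam hlam1 h.measureReal_mark_pos_async
      (PeakAge.hasDerivAt_asyncService hε1 n)
      (by
        have hne : (1 : ℝ) - ε ≠ 0 := by linarith
        rw [one_pow, mul_one, mul_one, div_self hne])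
      (fun s hs0 hs1 => (h.pgf_service_async hlam hε hε1 n
        (PeakAge.integrable_pow_of_norm_le_one
          (by rw [Real.norm_of_nonneg hs0.le]; exact hs1.le))).2)
      (by rwa [hM])
    have key : ∀ s : ℂ, s ≠ 1 → MeasureTheory.Integrable (fun k : ℕ => s ^ k) πD →
        PeakAge.pgf πD s = PeakAge.asyncDelayPGF n lam ε s := fun s hs1 hs => by
      obtain ⟨h1, h2, h3⟩ := hGD s hs1 hs
      obtain ⟨h4, h5⟩ := h.pgf_service_async hlam hε hε1 n h1
      rw [hM] at h3
      push_cast at h2 h3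
      rw [h3]
      exact PeakAge.asyncDelayPGF_eq hεne h4 h5 h2
    simp only [hα] at hD hA hAeq
    refine ⟨πD, πA, hD, hA, hAeq, key, fun s hs1 hs => ?_⟩
    obtain ⟨h1, h2, h3, h4, h5⟩ := hGA s hs
    obtain ⟨h6, h7⟩ := h.pgf_service_async hlam hε hε1 n h2
    rw [h5, key s hs1 h1, key _ h4 h3]
    push_cast
    congr 1
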